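/- Let $K$ be a field and let $\Lambda$ be a finite-dimensional symmetric $K$-algebra (there is a linear form $\nu:\Lambda\to K$ with $\nu(ab)=\nu(ba)$ for all $a,b$ whose kernel contains no nonzero left or right ideal) with $J(\Lambda)^3=0$, where $J(\Lambda)$ is the Jacobson radical. Let $S_1,\dots,S_n$ be the simple $\Lambda$-modules up to isomorphism. We say that $\Lambda$ is of type $\mathcal D$, for a diagram $\mathcal D$ with $n$ vertices, if, for a suitable numbering of the simple modules, $\dim_K\operatorname{Ext}^1_\Lambda(S_i,S_j)$ is the number of edges of $\mathcal D$ between $i$ and $j$, for all $i,j$ (a loop at $i$ counts as one edge from $i$ to $i$). Here $A_n$ ($n\ge 2$), $D_n$ ($n\ge 4$), $E_6,E_7,E_8$ are the Dynkin diagrams, and $L_n$ ($n\ge 2$) is the path with $n$ vertices together with one loop at one of its two end vertices. A projective resolution $\cdots\to P_1\to P_0\to S\to 0$ is minimal if each $P_k$ is a projective cover of the $k$-th syzygy $\Omega^k(S)$. Say that it repeats after $q\ge 1$ steps if the complex $\cdots\to P_{q+1}\to P_q$ is isomorphic to $\cdots\to P_1\to P_0$ (equivalently, $\Omega^q(S)\cong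 S$). The minimal projective resolutions of the simple $\Lambda$-modules are called periodic of period $p$ if all of them repeat after $p$ steps and $p$ is the least positive integer with this property. Then the simple $\Lambda$-modules have minimal projective resolutions, and these are periodic (a) of period $2n$ if $\Lambda$ is of type $A_n$; (b) of period $2n$ if $\Lambda$ is of type $L_n$; (c) of period $2n-3$ if $\Lambda$ is of type $D_n$ with $n$ even, and of period $2(2n-3)$ if $\Lambda$ is of type $D_n$ with $n$ odd; (d) of period $22$ if $\Lambda$ is of type $E_6$, of period $17$ if $\Lambda$ is of type $E_7$, and of period $29$ if $\Lambda$ is of type $E_8$. -/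

import Mathlib

open CategoryTheory

universe u v

noncomputable section

/-! ### Symmetric algebras -/

/-- A `K`-algebra `Λ` is symmetric if there is a linear form `ν` on `Λ` with `ν (ab) = ν (ba)`
whose kernel contains no nonzero left ideal and no nonzero right ideal. -/
def IsSymmetricAlg (K : Type v) (Λ : Type u) [Field K] [Ring Λ] [Algebra K Λ] : Prop :=
  ∃ ν : Λ →ₗ[K] K,
    (∀ a b : Λ, ν (a * b) = ν (b * a)) ∧
    (∀ I : Submodule Λ Λ, (∀ x ∈ I, ν x = 0) → I = ⊥) ∧
    (∀ I : Submodule Λᵐᵒᵖ Λ, (∀ x ∈ I, ν x = 0) → I = ⊥)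

/-! ### Diagrams

A diagram on the vertices `0, …, n - 1` is given by its adjacency matrix, whose `(i, j)` entry is
the number of edges between `i` and `j` (a loop counts once). The vertex that is usually labelled
`i + 1` is `i : Fin n`. -/

/-- The adjacency matrix of the diagram in which distinct vertices `i` and `j` are joined by an
edge if and only if `r i j` or `r j i` holds, and which has a loop at `i` if and only if `r i i`
holds. -/
def adjacencyOf (n : ℕ) (r : ℕ → ℕ → Prop) : Matrix (Fin n) (Fin n) ℕ :=
  open Classical in Matrix.of fun i j => if r i j ∨ r j i then 1 else 0

/-- The diagram `A_n`: the path `0 - 1 - ⋯ - (n - 1)`. -/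
def diagramA (n : ℕ) : Matrix (Fin n) (Fin n) ℕ :=
  adjacencyOf n fun i j => j = i + 1

/-- The diagram `L_n`: the path `0 - 1 - ⋯ - (n - 1)` with a loop at the end vertex `0`. -/
def diagramL (n : ℕ) : Matrix (Fin n) (Fin n) ℕ :=
  adjacencyOf n fun i j => j = i + 1 ∨ (i = 0 ∧ j = 0)

/-- The diagram `D_n` (`n ≥ 4`): the path `2 - 3 - ⋯ - (n - 1)`, with two further vertices `0` and
`1`, both joined to `2`. -/
def diagramD (n : ℕ) : Matrix (Fin n) (Fin n) ℕ :=
  adjacencyOf n fun i j => (i = 0 ∧ j = 2) ∨ (i = 1 ∧ j = 2) ∨ (2 ≤ i ∧ j = i + 1)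

/-- The diagram `E_n` (`n = 6, 7, 8`): the path `0 - 1 - ⋯ - (n - 2)`, with one further vertex
`n - 1`, joined to `2`. -/
def diagramE (n : ℕ) : Matrix (Fin n) (Fin n) ℕ :=
  adjacencyOf n fun i j => (j = i + 1 ∧ j + 1 < n) ∨ (i = 2 ∧ j + 1 = n)

/-! ### The diagram of an algebra -/

/-- The diagram of `Λ` is the diagram with adjacency matrix `A`: the simple `Λ`-modules, up to
isomorphism, can be listed without repetition as `S 0, …, S (n - 1)` in such a way that
`dim_K Ext¹(S i, S j) = A i j` for all `i` and `j`. -/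
def HasDiagram (K : Type v) (Λ : Type u) [Field K] [Ring Λ] [Algebra K Λ] {n : ℕ}
    (A : Matrix (Fin n) (Fin n) ℕ) : Prop :=
  ∃ S : Fin n → ModuleCat.{u} Λ,
    (∀ i, IsSimpleModule Λ (S i)) ∧
    (∀ i j, Nonempty (S i ≅ S j) → i = j) ∧
    (∀ T : ModuleCat.{u} Λ, IsSimpleModule Λ T → ∃ i, Nonempty (T ≅ S i)) ∧
    ∀ i j, Module.finrank K (Abelian.Ext (S i) (S j) 1) = A i j

/-! ### Minimal projective resolutions and their periods -/

variable {Λ : Type u} [Ring Λ]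

/-- A submodule `N` of `M` is superfluous if `N + L = M` forces `L = M`. -/
def IsSuperfluous {M : Type u} [AddCommGroup M] [Module Λ M] (N : Submodule Λ M) : Prop :=
  ∀ L : Submodule Λ M, N ⊔ L = ⊤ → L = ⊤

/-- A projective resolution `⋯ → P 1 → P 0 → M → 0` is minimal if each `P k` is a projective cover
of the `k`-th syzygy, that is, the kernel of the map out of `P k`, which is the image of the map
`P (k + 1) → P k`, is superfluous in `P k`. -/
def IsMinimalResolution {M : ModuleCat.{u} Λ} (P : ProjectiveResolution M) : Prop :=
  ∀ k : ℕ, IsSuperfluous (LinearMap.range (P.complex.d (k + 1) k).hom)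

/-- A projective resolution `P` repeats after `q` steps if the complex `⋯ → P (q + 1) → P q` is
isomorphic to the complex `⋯ → P 1 → P 0`. -/
def RepeatsAfter {M : ModuleCat.{u} Λ} (P : ProjectiveResolution M) (q : ℕ) : Prop :=
  ∃ φ : ∀ k : ℕ, P.complex.X (k + q) ≅ P.complex.X k,
    ∀ k : ℕ, P.complex.d (k + 1 + q) (k + q) ≫ (φ k).hom =
      (φ (k + 1)).hom ≫ P.complex.d (k + 1) k

/-- Every simple `Λ`-module has a minimal projective resolution, and every minimal projective
resolution of a simple `Λ`-module repeats after `q` steps. -/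
def SimpleResolutionsRepeatAfter (Λ : Type u) [Ring Λ] (q : ℕ) : Prop :=
  ∀ S : ModuleCat.{u} Λ, IsSimpleModule Λ S →
    (∃ P : ProjectiveResolution S, IsMinimalResolution P) ∧
    ∀ P : ProjectiveResolution S, IsMinimalResolution P → RepeatsAfter P q

/-- The minimal projective resolutions of the simple `Λ`-modules are periodic of period `p`: they
all repeat after `p` steps, and `p` is the least positive integer with this property. -/
def SimpleResolutionsHavePeriod (Λ : Type u) [Ring Λ] (p : ℕ) : Prop :=
  IsLeast {q : ℕ | 0 < q ∧ SimpleResolutionsRepeatAfter Λ q} p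

end

/-!
The module-theoretic data are read off dimensions. Write `S i` for the simple modules, `P i` for
their projective covers and `A` for the adjacency matrix of the diagram, so that the composition
factors of `J P i / J² P i` are counted by column `i` of `A`. Since `Λ` is symmetric, it is
self-injective, `dim Hom(P i, M) = dim Hom(M, P i)`, and `P i` has simple socle `S i = J² P i`;
hence a projective module with top multiplicities `t` has composition factors `2 t + A t`.

Let `M` be indecomposable with `J² M = 0`, with top multiplicities `t` and with the remaining
composition factors counted by `r`. Its syzygy `Ω M` is again indecomposable, contains
`J² P = soc P` for the projective cover `P` of `M`, and has composition factors `t + (A t - r)`. If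
`Ω M` is not simple, then its socle is its radical, so that the pair `(t, r)` turns into
`(A t - r, t)`; if it is `S s`, then `t = e_s` and `A t - r = 0`
(`RadCubeZeroData.HasRadicalVector.step`). Starting from `S i`, with the pair `(e_i, 0)`, the top of
`Ω^k (S i)` is therefore the column `S_k(A) e_i`, where `S_k` are the Chebyshev polynomials with
`S_(k + 1) = X S_k - S_(k - 1)`, up to the first index `m + 1` at which this column vanishes. There,
and not before, the syzygy is simple, namely `S s` with `S_m(A) e_i = e_s`.

For a connected diagram this first index is the same for all vertices, because the columns are
nonnegative up to the first zero (`RadCubeZeroData.firstZeroAt_of_connected`). So `S_(m + 1)(A)` is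
zero, and `S_m² + S_(m + 1)² - X S_m S_(m + 1) = 1` gives `S_m(A)² = 1`: the matrix `S_m(A)` is
that of the permutation `Ω^(m + 1)` of the simple modules, which is an involution. The period is
`m + 1` if `S_m(A) = 1` and `2 (m + 1)` otherwise (`HasDiagram.havePeriod`). Periodicity of the
syzygies is the same as periodicity of the resolutions, by uniqueness of projective covers
(`IsMinimalResolution.repeatsAfter_iff`).

It remains to compute, for each diagram, the columns `S_k(A) e_i` at one end vertex `i`, and to
decide whether `S_m(A)` is the identity. It fixes `e_i` in the cases `L_n`, `D_n`, `E_7` and `E_8`,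
and then all the columns `S_k(A) e_i`, since it commutes with `A`. These span everything except in
the case `D_n`, where `e_0 - e_1`, an eigenvector of `A` with eigenvalue `0`, has to be considered
separately; on it `S_m(A)`, with `m = 2 (n - 2)`, acts as `(-1)^(n - 2)`.
-/

noncomputable section

section Syzygies

/-! ### Projective covers -/

variable {Λ : Type u} [Ring Λ]

/-- A projective cover: a surjection from a projective module with superfluous kernel. -/
structure IsProjectiveCover {P M : Type u} [AddCommGroup P] [Module Λ P] [AddCommGroup M]
    [Module Λ M] (π : P →ₗ[Λ] M) : Prop where
  projective : Module.Projective Λ P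
  surjective : Function.Surjective π
  superfluous : IsSuperfluous (LinearMap.ker π)

section Covers

variable {P M P' M' : Type u} [AddCommGroup P] [Module Λ P] [AddCommGroup M] [Module Λ M]
  [AddCommGroup P'] [Module Λ P'] [AddCommGroup M'] [Module Λ M']

/-- Projective covers of isomorphic modules are isomorphic, compatibly with the isomorphism. -/
theorem IsProjectiveCover.exists_equiv {π : P →ₗ[Λ] M} {π' : P' →ₗ[Λ] M'}
    (h : IsProjectiveCover π) (h' : IsProjectiveCover π') (φ : M ≃ₗ[Λ] M') :
    ∃ f : P ≃ₗ[Λ] P', ∀ x, π' (f x) = φ (π x) := by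
  have := h.projective
  have := h'.projective
  obtain ⟨f, hf⟩ := Module.projective_lifting_property π' (φ.toLinearMap ∘ₗ π) h'.surjective
  have hf' : ∀ x, π' (f x) = φ (π x) := fun x => LinearMap.congr_fun hf x
  have hsurj : LinearMap.range f = ⊤ := by
    refine h'.superfluous _ (eq_top_iff.2 fun y _ => ?_)
    obtain ⟨x, hx⟩ := h.surjective (φ.symm (π' y))
    refine Submodule.mem_sup.2 ⟨y - f x, ?_, f x, ⟨x, rfl⟩, by abel⟩
    rw [LinearMap.mem_ker, map_sub, hf', hx, φ.apply_symm_apply, sub_self]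
  obtain ⟨s, hs⟩ := f.exists_rightInverse_of_surjective hsurj
  have hs' : ∀ y, f (s y) = y := fun y => LinearMap.congr_fun hs y
  have hs_range : LinearMap.range s = ⊤ := by
    refine h.superfluous _ (eq_top_iff.2 fun x _ => ?_)
    refine Submodule.mem_sup.2 ⟨x - s (f x), ?_, s (f x), ⟨_, rfl⟩, by abel⟩
    apply φ.injective
    rw [← hf', map_sub, hs', sub_self, map_zero, map_zero]
  refine ⟨LinearEquiv.ofBijective f ⟨?_, LinearMap.range_eq_top.1 hsurj⟩, hf'⟩
  refine (injective_iff_map_eq_zero f).2 fun x hx => ?_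
  obtain ⟨y, rfl⟩ := LinearMap.range_eq_top.1 hs_range x
  rw [hs'] at hx
  rw [hx, map_zero]

theorem IsProjectiveCover.nonempty_ker_equiv {π : P →ₗ[Λ] M} {π' : P' →ₗ[Λ] M'}
    (h : IsProjectiveCover π) (h' : IsProjectiveCover π') (φ : M ≃ₗ[Λ] M') :
    Nonempty (LinearMap.ker π ≃ₗ[Λ] LinearMap.ker π') := by
  obtain ⟨f, hf⟩ := h.exists_equiv h' φ
  refine ⟨f.ofSubmodules _ _ ?_⟩
  ext y
  simp only [Submodule.mem_map, LinearMap.mem_ker]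
  constructor
  · rintro ⟨x, hx, rfl⟩
    simp [hf, hx]
  · intro hy
    refine ⟨f.symm y, φ.injective ?_, by simp⟩
    rw [← hf]
    simp [hy]

theorem IsProjectiveCover.finite {π : P →ₗ[Λ] M} (h : IsProjectiveCover π)
    [Module.Finite Λ M] : Module.Finite Λ P := by
  obtain ⟨s, hs⟩ := Module.Finite.fg_top (R := Λ) (M := M)
  choose g hg using h.surjective
  classical
  refine ⟨⟨s.image g, h.superfluous _ ?_⟩⟩
  have : (Submodule.span Λ (s.image g : Set P)).map π = ⊤ := by
    rw [Submodule.map_span, ← hs]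
    congr 1
    ext x
    simp [hg]
  rw [sup_comm, ← Submodule.comap_map_eq, this, Submodule.comap_top]

end Covers

/-- A finitely generated module over an Artinian ring has a projective cover: among the finitely
generated projective modules mapping onto `M`, one of least length is a cover, because by Fitting's
lemma an endomorphism over `M` of such a module is bijective. -/
theorem exists_isProjectiveCover [IsArtinianRing Λ] (M : Type u) [AddCommGroup M] [Module Λ M]
    [Module.Finite Λ M] :
    ∃ (P : ModuleCat.{u} Λ) (π : P →ₗ[Λ] M), Module.Finite Λ P ∧ IsProjectiveCover π := by
  classical
  have hex : ∃ d : ℕ, ∃ (P : ModuleCat.{u} Λ) (π : P →ₗ[Λ] M), Module.Finite Λ P ∧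
      Module.Projective Λ P ∧ Function.Surjective π ∧ Module.length Λ P = d := by
    obtain ⟨n, f, hf⟩ := Module.Finite.exists_fin' Λ M
    obtain ⟨d, hd⟩ := ENat.ne_top_iff_exists.1
      (Module.length_ne_top (R := Λ) (M := Fin n → Λ))
    exact ⟨d, ModuleCat.of Λ (Fin n → Λ), f, inferInstanceAs (Module.Finite Λ (Fin n → Λ)),
      inferInstanceAs (Module.Projective Λ (Fin n → Λ)), hf, hd.symm⟩
  obtain ⟨P, π, hfin, hproj, hsurj, hlen⟩ := Nat.find_spec hex
  refine ⟨P, π, hfin, hproj, hsurj, fun L hL => ?_⟩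
  have hLs : Function.Surjective (π ∘ₗ L.subtype) := by
    intro m
    obtain ⟨x, rfl⟩ := hsurj m
    obtain ⟨y, hy, z, hz, rfl⟩ := Submodule.mem_sup.1 (hL ▸ Submodule.mem_top : x ∈ _ ⊔ L)
    refine ⟨⟨z, hz⟩, ?_⟩
    simp [LinearMap.mem_ker.1 hy]
  obtain ⟨h, hh⟩ := Module.projective_lifting_property (π ∘ₗ L.subtype) π hLs
  let f : Module.End Λ P := L.subtype ∘ₗ h
  have hf : ∀ x, π (f x) = π x := fun x => LinearMap.congr_fun hh x
  have hfn : ∀ (n : ℕ) (x : P), π ((f ^ n) x) = π x := by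
    intro n
    induction n with
    | zero => simp
    | succ n ih => intro x; rw [pow_succ, Module.End.mul_apply, ih, hf]
  obtain ⟨n, hn⟩ := Filter.eventually_atTop.1 f.eventually_isCompl_ker_pow_range_pow
  have hc := hn (n + 1) n.le_succ
  set R := LinearMap.range (f ^ (n + 1)) with hR
  have htop : R = ⊤ := by
    by_contra hne
    have hRproj : Module.Projective Λ R :=
      Module.Projective.of_split R.subtype (R.projectionOnto _ hc.symm)
        (by ext x; simp)
    have hlt := Submodule.length_lt hne
    rw [hlen] at hlt
    obtain ⟨d, hd⟩ := ENat.ne_top_iff_exists.1 hlt.ne_top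
    rw [← hd] at hlt
    refine Nat.find_min hex (m := d) (by exact_mod_cast hlt)
      ⟨ModuleCat.of Λ R, π ∘ₗ R.subtype, inferInstanceAs (Module.Finite Λ R), hRproj, ?_, hd.symm⟩
    intro m
    obtain ⟨x, rfl⟩ := hsurj m
    exact ⟨⟨(f ^ (n + 1)) x, ⟨x, rfl⟩⟩, hfn (n + 1) x⟩
  rw [eq_top_iff, ← htop, hR]
  rintro _ ⟨x, rfl⟩
  rw [pow_succ', Module.End.mul_apply]
  exact (h _).2

/-! ### Syzygies -/

/-- `IsSyzygy k M N` says that `N` is a `k`-th syzygy `Ω^k M` of `M`, defined by iterating kernels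
of projective covers and closed under isomorphism. -/
inductive IsSyzygy : ℕ → ModuleCat.{u} Λ → ModuleCat.{u} Λ → Prop
  | zero {M N : ModuleCat.{u} Λ} (e : M ≃ₗ[Λ] N) : IsSyzygy 0 M N
  | succ {k : ℕ} {M N P N' : ModuleCat.{u} Λ} (π : P →ₗ[Λ] N) (hπ : IsProjectiveCover π)
      (e : N' ≃ₗ[Λ] LinearMap.ker π) (h : IsSyzygy k M N) : IsSyzygy (k + 1) M N'

theorem IsSyzygy.nonempty_equiv {k : ℕ} {M N M' N' : ModuleCat.{u} Λ} (h : IsSyzygy k M N)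
    (h' : IsSyzygy k M' N') (e : M ≃ₗ[Λ] M') : Nonempty (N ≃ₗ[Λ] N') := by
  induction h generalizing N' with
  | zero e₁ => cases h' with | zero e₂ => exact ⟨e₁.symm.trans (e.trans e₂)⟩
  | succ π hπ e₁ _ ih =>
    cases h' with
    | succ π' hπ' e₂ h'' =>
      obtain ⟨φ⟩ := ih h'' e
      obtain ⟨ψ⟩ := hπ.nonempty_ker_equiv hπ' φ
      exact ⟨e₁.trans (ψ.trans e₂.symm)⟩

theorem IsSyzygy.trans_equiv {k : ℕ} {M N N' : ModuleCat.{u} Λ} (h : IsSyzygy k M N)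
    (e : N ≃ₗ[Λ] N') : IsSyzygy k M N' := by
  cases h with
  | zero e₁ => exact .zero (e₁.trans e)
  | succ π hπ e₁ h => exact .succ π hπ (e.symm.trans e₁) h

theorem IsSyzygy.add {a b : ℕ} {M N L : ModuleCat.{u} Λ} (h : IsSyzygy a M N)
    (h' : IsSyzygy b N L) : IsSyzygy (a + b) M L := by
  induction h' with
  | zero e => exact h.trans_equiv e
  | succ π hπ e _ ih => exact .succ π hπ e (ih h)

/-! ### Minimal resolutions and syzygies -/

/-- Two exact sequences `⋯ → X 1 → X 0` and `⋯ → Y 1 → Y 0` of projective modules with superfluous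
images are isomorphic as soon as the cokernels of their last maps are. -/
theorem exists_equiv_of_minimal {X Y : ℕ → ModuleCat.{u} Λ}
    (d : ∀ k, X (k + 1) →ₗ[Λ] X k) (d' : ∀ k, Y (k + 1) →ₗ[Λ] Y k)
    (hX : ∀ k, Module.Projective Λ (X k)) (hY : ∀ k, Module.Projective Λ (Y k))
    (hd : ∀ k, IsSuperfluous (LinearMap.range (d k)))
    (hd' : ∀ k, IsSuperfluous (LinearMap.range (d' k)))
    (ex : ∀ k, LinearMap.range (d (k + 1)) = LinearMap.ker (d k))
    (ex' : ∀ k, LinearMap.range (d' (k + 1)) = LinearMap.ker (d' k))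
    (e : (X 0 ⧸ LinearMap.range (d 0)) ≃ₗ[Λ] (Y 0 ⧸ LinearMap.range (d' 0))) :
    ∃ φ : ∀ k, X k ≃ₗ[Λ] Y k, ∀ k x, φ k (d k x) = d' k (φ (k + 1) x) := by
  have hstart : ∃ φ : X 0 ≃ₗ[Λ] Y 0, (LinearMap.range (d 0)).map φ.toLinearMap =
      LinearMap.range (d' 0) := by
    have h1 : IsProjectiveCover (LinearMap.range (d 0)).mkQ :=
      ⟨hX 0, Submodule.mkQ_surjective _, by rw [Submodule.ker_mkQ]; exact hd 0⟩
    have h2 : IsProjectiveCover (LinearMap.range (d' 0)).mkQ :=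
      ⟨hY 0, Submodule.mkQ_surjective _, by rw [Submodule.ker_mkQ]; exact hd' 0⟩
    obtain ⟨f, hf⟩ := h1.exists_equiv h2 e
    have key : ∀ x, f x ∈ LinearMap.range (d' 0) ↔ x ∈ LinearMap.range (d 0) := fun x => by
      have := hf x
      rw [← Submodule.Quotient.mk_eq_zero, ← Submodule.mkQ_apply, this,
        LinearEquiv.map_eq_zero_iff, Submodule.mkQ_apply, Submodule.Quotient.mk_eq_zero]
    refine ⟨f, ?_⟩
    ext y
    simp only [Submodule.mem_map]
    exact ⟨by rintro ⟨x, hx, rfl⟩; exact (key x).2 hx,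
      fun hy => ⟨f.symm y, (key _).1 (by simpa using hy), by simp⟩⟩
  have hstep : ∀ k (φ : X k ≃ₗ[Λ] Y k), (LinearMap.range (d k)).map φ.toLinearMap =
      LinearMap.range (d' k) → ∃ ψ : X (k + 1) ≃ₗ[Λ] Y (k + 1),
        (LinearMap.range (d (k + 1))).map ψ.toLinearMap = LinearMap.range (d' (k + 1)) ∧
          ∀ x, φ (d k x) = d' k (ψ x) := by
    intro k φ hφ
    have h1 : IsProjectiveCover (d k).rangeRestrict :=
      ⟨hX _, LinearMap.surjective_rangeRestrict _, by
        rw [LinearMap.ker_rangeRestrict, ← ex]; exact hd _⟩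
    have h2 : IsProjectiveCover (d' k).rangeRestrict :=
      ⟨hY _, LinearMap.surjective_rangeRestrict _, by
        rw [LinearMap.ker_rangeRestrict, ← ex']; exact hd' _⟩
    obtain ⟨f, hf⟩ := h1.exists_equiv h2 (φ.ofSubmodules _ _ hφ)
    have hf' : ∀ x, φ (d k x) = d' k (f x) := fun x => (congrArg Subtype.val (hf x)).symm
    refine ⟨f, ?_, hf'⟩
    rw [ex, ex']
    ext y
    simp only [Submodule.mem_map, LinearMap.mem_ker]
    constructor
    · rintro ⟨x, hx, rfl⟩
      have := hf' x
      rw [hx, map_zero] at this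
      exact this.symm
    · intro hy
      refine ⟨f.symm y, φ.injective ?_, by simp⟩
      rw [hf']
      simp [hy]
  choose step hstep1 hstep2 using hstep
  obtain ⟨φ₀, hφ₀⟩ := hstart
  let Φ : ∀ k, {φ : X k ≃ₗ[Λ] Y k // (LinearMap.range (d k)).map φ.toLinearMap =
      LinearMap.range (d' k)} := fun k =>
    Nat.rec ⟨φ₀, hφ₀⟩ (fun k φ => ⟨step k φ.1 φ.2, hstep1 k φ.1 φ.2⟩) k
  exact ⟨fun k => (Φ k).1, fun k x => hstep2 k (Φ k).1 (Φ k).2 x⟩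

section Resolutions

variable {M : ModuleCat.{u} Λ} (P : ProjectiveResolution M)

theorem resolution_projective (k : ℕ) : Module.Projective Λ (P.complex.X k) :=
  (IsProjective.iff_projective _).2 (P.projective k)

theorem resolution_range_d_eq_ker (i j l : ℕ) (hij : j + 1 = i) (hjl : l + 1 = j) :
    LinearMap.range (P.complex.d i j).hom = LinearMap.ker (P.complex.d j l).hom := by
  subst hjl
  subst hij
  exact (P.exact_succ l).moduleCat_range_eq_ker

/-- The augmentation `P 0 → M` of a projective resolution of `M`. -/
def resolutionAugmentation : P.complex.X 0 →ₗ[Λ] M :=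
  (show P.complex.X 0 ⟶ M from P.π.f 0).hom

theorem resolutionAugmentation_surjective : Function.Surjective (resolutionAugmentation P) := by
  have : Epi (show P.complex.X 0 ⟶ M from P.π.f 0) := inferInstanceAs (Epi (P.π.f 0))
  exact (ModuleCat.epi_iff_surjective _).1 this

theorem ker_resolutionAugmentation :
    LinearMap.ker (resolutionAugmentation P) = LinearMap.range (P.complex.d 1 0).hom :=
  (P.exact₀.moduleCat_range_eq_ker).symm

/-- The image of `P (k + 1) → P k` in a minimal projective resolution of `M` is a
`(k + 1)`-st syzygy of `M`. -/
theorem IsMinimalResolution.isSyzygy (hP : IsMinimalResolution P) (k : ℕ) :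
    IsSyzygy (k + 1) M (ModuleCat.of Λ (LinearMap.range (P.complex.d (k + 1) k).hom)) := by
  induction k with
  | zero =>
    refine .succ (resolutionAugmentation P)
      ⟨resolution_projective P 0, resolutionAugmentation_surjective P, ?_⟩
      (LinearEquiv.ofEq _ _ (ker_resolutionAugmentation P).symm) (.zero (LinearEquiv.refl Λ M))
    rw [ker_resolutionAugmentation]
    exact hP 0
  | succ k ih =>
    have hker : LinearMap.ker (P.complex.d (k + 1) k).hom.rangeRestrict =
        LinearMap.range (P.complex.d (k + 1 + 1) (k + 1)).hom := by
      rw [LinearMap.ker_rangeRestrict, resolution_range_d_eq_ker P (k + 1 + 1) (k + 1) k rfl rfl]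
    refine .succ (N := ModuleCat.of Λ (LinearMap.range (P.complex.d (k + 1) k).hom))
      (P.complex.d (k + 1) k).hom.rangeRestrict
      ⟨resolution_projective P _, LinearMap.surjective_rangeRestrict _, ?_⟩
      (LinearEquiv.ofEq _ _ hker.symm) ih
    rw [hker]
    exact hP (k + 1)

/-- The cokernel of the last map of the shifted complex `⋯ → P (q + 1) → P q`. -/
theorem nonempty_quotient_equiv_range (q : ℕ) :
    Nonempty ((P.complex.X (q + 1) ⧸ LinearMap.range (P.complex.d (q + 1 + 1) (q + 1)).hom) ≃ₗ[Λ]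
      LinearMap.range (P.complex.d (q + 1) q).hom) :=
  ⟨(Submodule.quotEquivOfEq _ _ (resolution_range_d_eq_ker P (q + 1 + 1) (q + 1) q rfl rfl)).trans
    (P.complex.d (q + 1) q).hom.quotKerEquivRange⟩

/-- A minimal projective resolution of `M` repeats after `q ≥ 1` steps if and only if `M` is its own
`q`-th syzygy. -/
theorem IsMinimalResolution.repeatsAfter_iff (hP : IsMinimalResolution P) {q : ℕ} (hq : 0 < q) :
    RepeatsAfter P q ↔ IsSyzygy q M M := by
  obtain ⟨q, rfl⟩ := Nat.exists_eq_succ_of_ne_zero hq.ne'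
  rw [Nat.succ_eq_add_one]
  obtain ⟨e⟩ := nonempty_quotient_equiv_range P q
  let e₀ : (P.complex.X 0 ⧸ LinearMap.range (P.complex.d 1 0).hom) ≃ₗ[Λ] M :=
    (Submodule.quotEquivOfEq _ _ (ker_resolutionAugmentation P).symm).trans
      ((resolutionAugmentation P).quotKerEquivOfSurjective (resolutionAugmentation_surjective P))
  have hidx : ∀ k, k + 1 + (q + 1) = k + (q + 1) + 1 := fun k => by omega
  constructor
  · rintro ⟨φ, hφ⟩
    have hmap : (LinearMap.range (P.complex.d (0 + 1 + (q + 1)) (0 + (q + 1))).hom).map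
        (φ 0).toLinearEquiv.toLinearMap = LinearMap.range (P.complex.d (0 + 1) 0).hom := by
      have h : ∀ x, (φ 0).hom.hom ((P.complex.d (0 + 1 + (q + 1)) (0 + (q + 1))).hom x) =
          (P.complex.d (0 + 1) 0).hom ((φ (0 + 1)).hom.hom x) := fun x =>
        ConcreteCategory.congr_hom (hφ 0) x
      ext y
      constructor
      · rintro ⟨_, ⟨x, rfl⟩, rfl⟩
        exact ⟨_, (h x).symm⟩
      · rintro ⟨x, rfl⟩
        refine ⟨_, ⟨(φ (0 + 1)).inv.hom x, rfl⟩, (h _).trans ?_⟩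
        congr 1
        exact (φ (0 + 1)).toLinearEquiv.apply_symm_apply x
    have e₁ := Submodule.Quotient.equiv _ _ (φ 0).toLinearEquiv hmap
    have e₂ : (P.complex.X (0 + (q + 1)) ⧸ LinearMap.range
        (P.complex.d (0 + 1 + (q + 1)) (0 + (q + 1))).hom) ≃ₗ[Λ]
        LinearMap.range (P.complex.d (q + 1) q).hom := by
      rw [Nat.zero_add, Nat.add_comm 1]
      exact e
    exact (hP.isSyzygy P q).trans_equiv (e₂.symm.trans (e₁.trans e₀))
  · intro h
    obtain ⟨f⟩ := (hP.isSyzygy P q).nonempty_equiv h (LinearEquiv.refl Λ M)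
    have e₂ : (P.complex.X (0 + (q + 1)) ⧸ LinearMap.range
        (P.complex.d (0 + 1 + (q + 1)) (0 + (q + 1))).hom) ≃ₗ[Λ]
        LinearMap.range (P.complex.d (q + 1) q).hom := by
      rw [Nat.zero_add, Nat.add_comm 1]
      exact e
    obtain ⟨φ, hφ⟩ := exists_equiv_of_minimal
      (X := fun k => P.complex.X (k + (q + 1))) (Y := fun k => P.complex.X k)
      (fun k => (P.complex.d (k + 1 + (q + 1)) (k + (q + 1))).hom)
      (fun k => (P.complex.d (k + 1) k).hom)
      (fun k => resolution_projective P _) (fun k => resolution_projective P _)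
      (fun k => by
        have := hP (k + (q + 1))
        rw [← hidx k] at this
        exact this)
      hP
      (fun k => resolution_range_d_eq_ker P _ _ _ (by omega) (by omega))
      (fun k => resolution_range_d_eq_ker P _ _ _ (by omega) (by omega))
      (e₂.trans (f.trans e₀.symm))
    refine ⟨fun k => (φ k).toModuleIso, fun k => ?_⟩
    ext x
    exact hφ k x

end Resolutions

/-! ### Existence of minimal resolutions -/

section Existence

variable [IsArtinianRing Λ]

/-- Iterating projective covers: exact pieces `0 → Ω (k + 1) → X k → Ω k → 0` with `Ω 0 = M`. -/
theorem exists_cover_sequence (M : ModuleCat.{u} Λ) [hM : Module.Finite Λ M] :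
    ∃ (X Ω : ℕ → ModuleCat.{u} Λ) (c : ∀ k, X k →ₗ[Λ] Ω k) (ι : ∀ k, Ω (k + 1) →ₗ[Λ] X k),
      Nonempty (Ω 0 ≃ₗ[Λ] M) ∧ (∀ k, IsProjectiveCover (c k)) ∧
      (∀ k, Function.Injective (ι k)) ∧ ∀ k, LinearMap.range (ι k) = LinearMap.ker (c k) := by
  have hstep : ∀ N : {N : ModuleCat.{u} Λ // Module.Finite Λ N},
      ∃ (N' : {N : ModuleCat.{u} Λ // Module.Finite Λ N}) (X : ModuleCat.{u} Λ)
        (c : X →ₗ[Λ] N.1) (ι : N'.1 →ₗ[Λ] X), IsProjectiveCover c ∧ Function.Injective ι ∧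
        LinearMap.range ι = LinearMap.ker c := by
    rintro ⟨N, hN⟩
    obtain ⟨X, c, hX, hc⟩ := exists_isProjectiveCover (Λ := Λ) N
    exact ⟨⟨ModuleCat.of Λ (LinearMap.ker c), inferInstanceAs (Module.Finite Λ (LinearMap.ker c))⟩,
      X, c, (LinearMap.ker c).subtype, hc, Subtype.val_injective, Submodule.range_subtype _⟩
  choose next X c ι hc hι hr using hstep
  let Ω : ℕ → {N : ModuleCat.{u} Λ // Module.Finite Λ N} := fun k =>
    Nat.rec ⟨M, hM⟩ (fun _ N => next N) k
  exact ⟨fun k => X (Ω k), fun k => (Ω k).1, fun k => c (Ω k), fun k => ι (Ω k),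
    ⟨LinearEquiv.refl Λ M⟩, fun k => hc _, fun k => hι _, fun k => hr _⟩

theorem exists_isMinimalResolution (M : ModuleCat.{u} Λ) [hM : Module.Finite Λ M] :
    ∃ P : ProjectiveResolution M, IsMinimalResolution P := by
  obtain ⟨X, Ω, c, ι, ⟨e⟩, hc, hι, hr⟩ := exists_cover_sequence M
  let d : ∀ k, X (k + 1) ⟶ X k := fun k => ModuleCat.ofHom (ι k ∘ₗ c (k + 1))
  have hrange : ∀ k, LinearMap.range (d k).hom = LinearMap.ker (c k) := fun k => by
    rw [ModuleCat.hom_ofHom, LinearMap.range_comp,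
      LinearMap.range_eq_top.2 (hc (k + 1)).surjective, Submodule.map_top, hr]
  have hker : ∀ k, LinearMap.ker (d k).hom = LinearMap.ker (c (k + 1)) := fun k => by
    rw [ModuleCat.hom_ofHom, LinearMap.ker_comp, LinearMap.ker_eq_bot.2 (hι k),
      Submodule.comap_bot]
  have hexact : ∀ k x, (d k).hom x = 0 ↔ ∃ y, (d (k + 1)).hom y = x := fun k x => by
    rw [← LinearMap.mem_ker, hker, ← hrange, LinearMap.mem_range]
  have hdd : ∀ k, d (k + 1) ≫ d k = 0 := fun k => by
    ext x
    exact (hexact k _).2 ⟨x, rfl⟩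
  let C : ChainComplex (ModuleCat.{u} Λ) ℕ := ChainComplex.of X d hdd
  have hC : ∀ k, C.d (k + 1) k = d k := fun k => ChainComplex.of_d X d k
  let ε : X 0 ⟶ M := ModuleCat.ofHom (e.toLinearMap ∘ₗ c 0)
  have hεk : ∀ x, ε.hom x = 0 ↔ ∃ y, (d 0).hom y = x := fun x => by
    rw [← LinearMap.mem_range, hrange, LinearMap.mem_ker]
    exact e.map_eq_zero_iff
  have hε : C.d 1 0 ≫ ε = 0 := by
    rw [hC 0]
    ext x
    exact (hεk _).2 ⟨x, rfl⟩
  have hεs : Function.Surjective ε.hom := e.surjective.comp (hc 0).surjective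
  let P : ProjectiveResolution M :=
    { complex := C
      projective := fun n => (IsProjective.iff_projective _).1 (hc n).projective
      π := (ChainComplex.toSingle₀Equiv _ _).symm ⟨ε, hε⟩
      quasiIso := ⟨fun n => by
        cases n with
        | zero =>
          rw [ChainComplex.quasiIsoAt₀_iff, ShortComplex.quasiIso_iff_of_zeros']
          · have hx : (ShortComplex.mk (d 0) ε (by rw [← hC 0]; exact hε)).Exact :=
              (ShortComplex.moduleCat_exact_iff _).2 fun x hx => (hεk x).1 hx
            have : Epi ε := (ModuleCat.epi_iff_surjective _).2 hεs
            refine (ShortComplex.exact_and_epi_g_iff_of_iso ?_).2 ⟨hx, this⟩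
            exact ShortComplex.isoMk (Iso.refl _) (Iso.refl _) (Iso.refl _)
              ((Category.id_comp _).trans ((hC 0).symm.trans (Category.comp_id _).symm))
              ((Category.id_comp _).trans (ChainComplex.toSingle₀Equiv_symm_apply_f_zero
                (C := C) ε hε ▸ (Category.comp_id ε).symm))
          all_goals rfl
        | succ n =>
          rw [quasiIsoAt_iff_exactAt']
          · rw [HomologicalComplex.exactAt_iff' _ (n + 1 + 1) (n + 1) n (by simp) (by simp)]
            rw [ShortComplex.moduleCat_exact_iff]
            intro x hx
            change (C.d (n + 1) n).hom x = 0 at hx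
            change ∃ y, (C.d (n + 1 + 1) (n + 1)).hom y = x
            rw [hC] at hx ⊢
            exact (hexact n x).1 hx
          · apply ChainComplex.exactAt_succ_single_obj⟩ }
  refine ⟨P, fun k => ?_⟩
  have h : P.complex.d (k + 1) k = d k := hC k
  rw [h]
  exact (hrange k).symm ▸ (hc k).superfluous

end Existence

end Syzygies

/-! ### Dimensions of spaces of homomorphisms -/

/-- The `K`-dimension of `Hom_Λ(M, N)`. The `K`-structure on `N` is the one obtained by restricting
scalars, so that the definition only involves `Λ`-modules. -/
def homDim (K : Type v) (Λ : Type u) [Field K] [Ring Λ] [Algebra K Λ] (M N : Type u)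
    [AddCommGroup M] [Module Λ M] [AddCommGroup N] [Module Λ N] : ℕ :=
  letI : Module K N := Module.restrictScalars K Λ N
  haveI : IsScalarTower K Λ N := IsScalarTower.restrictScalars K Λ N
  Module.finrank K (M →ₗ[Λ] N)

/-- A linear map vanishing on the kernel of a surjection `g` factors through `g`. -/
theorem exists_comp_eq_of_ker_le {Λ M M' N : Type*} [Ring Λ] [AddCommGroup M] [Module Λ M]
    [AddCommGroup M'] [Module Λ M'] [AddCommGroup N] [Module Λ N] (g : M →ₗ[Λ] M')
    (hg : Function.Surjective g) (f : M →ₗ[Λ] N) (h : LinearMap.ker g ≤ LinearMap.ker f) :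
    ∃ k : M' →ₗ[Λ] N, k ∘ₗ g = f := by
  refine ⟨(LinearMap.ker g).liftQ f h ∘ₗ (g.quotKerEquivOfSurjective hg).symm.toLinearMap, ?_⟩
  ext x
  have : (g.quotKerEquivOfSurjective hg).symm (g x) = Submodule.Quotient.mk x := by
    rw [LinearEquiv.symm_apply_eq]
    rfl
  simp [this]

section HomDim

variable (K : Type v) {Λ : Type u} [Field K] [Ring Λ] [Algebra K Λ]
  {M N M' N' : Type u} [AddCommGroup M] [Module Λ M] [AddCommGroup N] [Module Λ N]
  [AddCommGroup M'] [Module Λ M'] [AddCommGroup N'] [Module Λ N']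

theorem finite_hom [Module.Finite K Λ] [Module K M] [IsScalarTower K Λ M] [Module K N]
    [IsScalarTower K Λ N] [Module.Finite Λ M] [Module.Finite Λ N] :
    Module.Finite K (M →ₗ[Λ] N) := by
  have := Module.Finite.trans (R := K) Λ M
  have := Module.Finite.trans (R := K) Λ N
  exact Module.Finite.of_injective (LinearMap.restrictScalarsₗ K Λ M N K)
    (LinearMap.restrictScalars_injective K)

/-- Precomposition with a surjection `g : M → M'` identifies `Hom(M', N)` and `Hom(M, N)` if every
map `M → N` vanishes on the kernel of `g`. -/
theorem homDim_eq_of_ker_le (g : M →ₗ[Λ] M') (hg : Function.Surjective g)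
    (h : ∀ f : M →ₗ[Λ] N, LinearMap.ker g ≤ LinearMap.ker f) :
    homDim K Λ M' N = homDim K Λ M N := by
  let _ : Module K N := Module.restrictScalars K Λ N
  have : IsScalarTower K Λ N := IsScalarTower.restrictScalars K Λ N
  refine (LinearEquiv.ofBijective (LinearMap.lcomp K N g)
    ⟨fun a b hab => ?_, fun f => ?_⟩).finrank_eq
  · ext x
    obtain ⟨y, rfl⟩ := hg x
    exact LinearMap.congr_fun hab y
  · exact exists_comp_eq_of_ker_le g hg f (h f)

/-- Postcomposition with an injection `g : N → N'` identifies `Hom(M, N)` and `Hom(M, N')` if every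
map `M → N'` takes its values in the range of `g`. -/
theorem homDim_eq_of_le_range (g : N →ₗ[Λ] N') (hg : Function.Injective g)
    (h : ∀ f : M →ₗ[Λ] N', LinearMap.range f ≤ LinearMap.range g) :
    homDim K Λ M N = homDim K Λ M N' := by
  let _ : Module K N := Module.restrictScalars K Λ N
  have : IsScalarTower K Λ N := IsScalarTower.restrictScalars K Λ N
  let _ : Module K N' := Module.restrictScalars K Λ N'
  have : IsScalarTower K Λ N' := IsScalarTower.restrictScalars K Λ N'
  refine (LinearEquiv.ofBijective (LinearMap.compRight K g (M := M))
    ⟨fun a b hab => ?_, fun f => ?_⟩).finrank_eq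
  · ext x
    exact hg (LinearMap.congr_fun hab x)
  · refine ⟨(LinearEquiv.ofInjective g hg).symm.toLinearMap ∘ₗ
      f.codRestrict (LinearMap.range g) fun x => h f ⟨x, rfl⟩, ?_⟩
    ext x
    simp only [LinearMap.compRight_apply, LinearMap.comp_apply, LinearEquiv.coe_coe]
    have := (LinearEquiv.ofInjective g hg).apply_symm_apply (f.codRestrict (LinearMap.range g)
      (fun x => h f ⟨x, rfl⟩) x)
    exact congrArg Subtype.val this

theorem homDim_congr_left (e : M ≃ₗ[Λ] M') : homDim K Λ M N = homDim K Λ M' N :=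
  (homDim_eq_of_ker_le K e.toLinearMap e.surjective fun f => by
    rw [e.ker]
    exact bot_le).symm

theorem homDim_congr_right (e : N ≃ₗ[Λ] N') : homDim K Λ M N = homDim K Λ M N' :=
  homDim_eq_of_le_range K e.toLinearMap e.injective fun f => by
    rw [e.range]
    exact le_top

theorem homDim_prod_right [Module.Finite K Λ] [Module.Finite Λ M] [Module.Finite Λ N]
    [Module.Finite Λ N'] : homDim K Λ M (N × N') = homDim K Λ M N + homDim K Λ M N' := by
  let _ : Module K M := Module.restrictScalars K Λ M
  have : IsScalarTower K Λ M := IsScalarTower.restrictScalars K Λ M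
  let _ : Module K N := Module.restrictScalars K Λ N
  have : IsScalarTower K Λ N := IsScalarTower.restrictScalars K Λ N
  let _ : Module K N' := Module.restrictScalars K Λ N'
  have : IsScalarTower K Λ N' := IsScalarTower.restrictScalars K Λ N'
  have := finite_hom K (Λ := Λ) (M := M) (N := N)
  have := finite_hom K (Λ := Λ) (M := M) (N := N')
  exact (LinearMap.prodEquiv K).finrank_eq.symm.trans Module.finrank_prod

theorem homDim_prod_left [Module.Finite K Λ] [Module.Finite Λ M] [Module.Finite Λ M']
    [Module.Finite Λ N] : homDim K Λ (M × M') N = homDim K Λ M N + homDim K Λ M' N := by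
  let _ : Module K M := Module.restrictScalars K Λ M
  have : IsScalarTower K Λ M := IsScalarTower.restrictScalars K Λ M
  let _ : Module K M' := Module.restrictScalars K Λ M'
  have : IsScalarTower K Λ M' := IsScalarTower.restrictScalars K Λ M'
  let _ : Module K N := Module.restrictScalars K Λ N
  have : IsScalarTower K Λ N := IsScalarTower.restrictScalars K Λ N
  have := finite_hom K (Λ := Λ) (M := M) (N := N)
  have := finite_hom K (Λ := Λ) (M := M') (N := N)
  exact (LinearMap.coprodEquiv K).finrank_eq.symm.trans Module.finrank_prod

theorem homDim_eq_zero_iff [Module.Finite K Λ] [Module.Finite Λ M] [Module.Finite Λ N] :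
    homDim K Λ M N = 0 ↔ ∀ f : M →ₗ[Λ] N, f = 0 := by
  let _ : Module K M := Module.restrictScalars K Λ M
  have : IsScalarTower K Λ M := IsScalarTower.restrictScalars K Λ M
  let _ : Module K N := Module.restrictScalars K Λ N
  have : IsScalarTower K Λ N := IsScalarTower.restrictScalars K Λ N
  have := finite_hom K (Λ := Λ) (M := M) (N := N)
  exact Module.finrank_zero_iff.trans
    ⟨fun h f => Subsingleton.elim _ _, fun h => ⟨fun f g => (h f).trans (h g).symm⟩⟩

theorem homDim_eq_zero_of_subsingleton [Subsingleton M] : homDim K Λ M N = 0 := by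
  let _ : Module K N := Module.restrictScalars K Λ N
  have : IsScalarTower K Λ N := IsScalarTower.restrictScalars K Λ N
  exact Module.finrank_zero_of_subsingleton

theorem homDim_eq_zero_of_subsingleton_right [Subsingleton N] : homDim K Λ M N = 0 := by
  let _ : Module K N := Module.restrictScalars K Λ N
  have : IsScalarTower K Λ N := IsScalarTower.restrictScalars K Λ N
  have : Subsingleton (M →ₗ[Λ] N) := ⟨fun f g => by ext; exact Subsingleton.elim _ _⟩
  exact Module.finrank_zero_of_subsingleton

/-- `Hom(M, -)` is exact, on dimensions, along `g : N → N'` as soon as every map `M → N'` lifts. -/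
theorem homDim_add_of_lift [Module.Finite K Λ] [Module.Finite Λ M] [Module.Finite Λ N]
    (g : N →ₗ[Λ] N') (h : ∀ f : M →ₗ[Λ] N', ∃ f', g ∘ₗ f' = f) :
    homDim K Λ M N = homDim K Λ M (LinearMap.ker g) + homDim K Λ M N' := by
  let _ : Module K M := Module.restrictScalars K Λ M
  have : IsScalarTower K Λ M := IsScalarTower.restrictScalars K Λ M
  let _ : Module K N := Module.restrictScalars K Λ N
  have : IsScalarTower K Λ N := IsScalarTower.restrictScalars K Λ N
  let _ : Module K N' := Module.restrictScalars K Λ N'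
  have : IsScalarTower K Λ N' := IsScalarTower.restrictScalars K Λ N'
  let _ : Module K (LinearMap.ker g) := Module.restrictScalars K Λ (LinearMap.ker g)
  have : IsScalarTower K Λ (LinearMap.ker g) := IsScalarTower.restrictScalars K Λ _
  have := finite_hom K (Λ := Λ) (M := M) (N := N)
  have h1 := LinearMap.finrank_range_add_finrank_ker (LinearMap.compRight K g (M := M))
  rw [LinearMap.range_eq_top.2 fun f => h f, finrank_top] at h1
  have h2 : LinearMap.ker (LinearMap.compRight K g (M := M)) =
      LinearMap.range (LinearMap.compRight K (LinearMap.ker g).subtype (M := M)) := by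
    ext f
    constructor
    · intro hf
      exact ⟨f.codRestrict _ fun x => LinearMap.congr_fun hf x, rfl⟩
    · rintro ⟨f, rfl⟩
      ext x
      exact (f x).2
  rw [h2, LinearMap.finrank_range_of_inj fun a b hab =>
    LinearMap.ext fun x => Subtype.ext (LinearMap.congr_fun hab x)] at h1
  rw [add_comm]
  exact h1.symm

theorem homDim_add [Module.Finite K Λ] [Module.Finite Λ M] [Module.Finite Λ N]
    [Module.Projective Λ M] (g : N →ₗ[Λ] N') (hg : Function.Surjective g) :
    homDim K Λ M N = homDim K Λ M (LinearMap.ker g) + homDim K Λ M N' :=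
  homDim_add_of_lift K g fun f => Module.projective_lifting_property g f hg

theorem homDim_add_quotient [Module.Finite K Λ] [Module.Finite Λ M] [Module.Finite Λ N]
    [Module.Projective Λ M] (L : Submodule Λ N) :
    homDim K Λ M N = homDim K Λ M L + homDim K Λ M (N ⧸ L) := by
  rw [homDim_add K L.mkQ L.mkQ_surjective,
    homDim_congr_right K (LinearEquiv.ofEq _ _ L.ker_mkQ)]

end HomDim

/-! ### Symmetric algebras: self-injectivity and symmetry of dimensions -/

section Symmetric

variable {K : Type v} {Λ : Type u} [Field K] [Ring Λ] [Algebra K Λ]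

/-- A form whose kernel contains no nonzero left ideal separates elements. -/
theorem eq_zero_of_form {ν : Λ →ₗ[K] K}
    (hl : ∀ I : Submodule Λ Λ, (∀ x ∈ I, ν x = 0) → I = ⊥) {y : Λ} (h : ∀ a, ν (a * y) = 0) :
    y = 0 := by
  have := hl (Submodule.span Λ {y}) fun x hx => by
    obtain ⟨a, rfl⟩ := Submodule.mem_span_singleton.1 hx
    exact h a
  exact Submodule.span_singleton_eq_bot.1 this

variable [Module.Finite K Λ]

/-- Every linear form on `Λ` is `a ↦ ν (a * y)` for some `y`. -/
theorem exists_form_eq {ν : Λ →ₗ[K] K}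
    (hl : ∀ I : Submodule Λ Λ, (∀ x ∈ I, ν x = 0) → I = ⊥) (φ : Λ →ₗ[K] K) :
    ∃ y, ∀ a, φ a = ν (a * y) := by
  let T : Λ →ₗ[K] Module.Dual K Λ :=
    { toFun := fun y => ν ∘ₗ LinearMap.mulRight K y
      map_add' := fun x y => by ext; simp [mul_add]
      map_smul' := fun c y => by ext; simp }
  have hT : Function.Injective T := (injective_iff_map_eq_zero T).2 fun y hy =>
    eq_zero_of_form hl fun a => LinearMap.congr_fun hy a
  obtain ⟨y, hy⟩ := (LinearMap.injective_iff_surjective_of_finrank_eq_finrank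
    (Subspace.dual_finrank_eq (K := K) (V := Λ)).symm).1 hT φ
  exact ⟨y, fun a => (LinearMap.congr_fun hy a).symm⟩

/-- Every linear form on a `Λ`-module `M` is `ν ∘ G` for a `Λ`-linear map `G : M → Λ`. -/
theorem exists_linearMap_form_eq {ν : Λ →ₗ[K] K}
    (hl : ∀ I : Submodule Λ Λ, (∀ x ∈ I, ν x = 0) → I = ⊥)
    {M : Type u} [AddCommGroup M] [Module Λ M] [Module K M] [IsScalarTower K Λ M]
    (φ : M →ₗ[K] K) : ∃ G : M →ₗ[Λ] Λ, ∀ m, φ m = ν (G m) := by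
  have h : ∀ m, ∃ y, ∀ a, φ (a • m) = ν (a * y) := fun m =>
    exists_form_eq hl (φ ∘ₗ (LinearMap.toSpanSingleton Λ M m).restrictScalars K)
  choose G hG using h
  have huniq : ∀ m y, (∀ a, φ (a • m) = ν (a * y)) → G m = y := fun m y hy =>
    sub_eq_zero.1 (eq_zero_of_form hl fun a => by rw [mul_sub, map_sub, ← hG, ← hy, sub_self])
  have hadd : ∀ x y, G (x + y) = G x + G y := fun x y => huniq _ _ fun a => by
    rw [smul_add, map_add, mul_add, map_add, hG, hG]
  have hsmul : ∀ (b : Λ) x, G (b • x) = b • G x := fun b x => huniq _ _ fun a => by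
    rw [smul_smul, smul_eq_mul, hG, mul_assoc]
  exact ⟨{ toFun := G, map_add' := hadd, map_smul' := hsmul }, fun m => by simpa using hG m 1⟩

/-- A symmetric algebra is self-injective. -/
theorem IsSymmetricAlg.injective (h : IsSymmetricAlg K Λ) : Module.Injective Λ Λ := by
  obtain ⟨ν, -, hl, -⟩ := h
  refine Module.Baer.injective fun I g => ?_
  obtain ⟨φ, hφ⟩ := LinearMap.exists_extend (p := I.restrictScalars K)
    (ν ∘ₗ g.restrictScalars K)
  have hφ' : ∀ x (hx : x ∈ I), φ x = ν (g ⟨x, hx⟩) := fun x hx =>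
    LinearMap.congr_fun hφ ⟨x, hx⟩
  obtain ⟨y, hy⟩ := exists_form_eq hl φ
  refine ⟨LinearMap.toSpanSingleton Λ Λ y, fun x hx => ?_⟩
  refine sub_eq_zero.1 (eq_zero_of_form hl fun a => ?_)
  have h1 : a * g ⟨x, hx⟩ = g ⟨a * x, I.mul_mem_left a hx⟩ := (map_smul g a ⟨x, hx⟩).symm
  rw [mul_sub, map_sub, h1, ← hφ', hy, LinearMap.toSpanSingleton_apply, smul_eq_mul, mul_assoc,
    sub_self]

/-- Finitely generated projective modules over a symmetric algebra are injective. -/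
theorem IsSymmetricAlg.injective_of_projective (h : IsSymmetricAlg K Λ) (P : Type u)
    [AddCommGroup P] [Module Λ P] [Module.Finite Λ P] [Module.Projective Λ P] :
    Module.Injective Λ P := by
  have := h.injective
  obtain ⟨n, f, hf⟩ := Module.Finite.exists_fin' Λ P
  obtain ⟨s, hs⟩ := Module.projective_lifting_property f LinearMap.id hf
  have : Module.Injective Λ (Fin n → Λ) := inferInstance
  refine ⟨fun X Y _ _ _ _ i hi g => ?_⟩
  obtain ⟨k, hk⟩ := this.out i hi (s ∘ₗ g)
  refine ⟨f ∘ₗ k, fun x => ?_⟩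
  rw [LinearMap.comp_apply, hk]
  exact LinearMap.congr_fun hs (g x)

/-- Over a symmetric algebra, `Hom(P, M)` and `Hom(M, P)` are dual to each other for a direct
summand `P` of `Λ`: the pairing sends `(f, g)` to the value of the form at `g f`, read as an element
of `Λ`. -/
theorem IsSymmetricAlg.homDim_comm (h : IsSymmetricAlg K Λ) {P M : Type u} [AddCommGroup P]
    [Module Λ P] [AddCommGroup M] [Module Λ M] [Module.Finite Λ P] [Module.Finite Λ M]
    (i : P →ₗ[Λ] Λ) (p : Λ →ₗ[Λ] P) (hpi : ∀ x, p (i x) = x) :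
    homDim K Λ P M = homDim K Λ M P := by
  obtain ⟨ν, hν, hl, -⟩ := h
  let _ : Module K M := Module.restrictScalars K Λ M
  have : IsScalarTower K Λ M := IsScalarTower.restrictScalars K Λ M
  let _ : Module K P := Module.restrictScalars K Λ P
  have : IsScalarTower K Λ P := IsScalarTower.restrictScalars K Λ P
  have := finite_hom K (Λ := Λ) (M := M) (N := P)
  have := finite_hom K (Λ := Λ) (M := P) (N := M)
  have hp : ∀ a, p a = a • p 1 := fun a => by rw [← map_smul, smul_eq_mul, mul_one]
  have hx : ∀ x, x = i x • p 1 := fun x => by rw [← hp, hpi]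
  have hf : ∀ (f : P →ₗ[Λ] M) x, f x = i x • f (p 1) := fun f x => by
    rw [← map_smul, ← hx]
  have hi : ∀ x, i x = i x * i (p 1) := fun x => by
    rw [← smul_eq_mul, ← map_smul, ← hx]
  let B : (P →ₗ[Λ] M) →ₗ[K] (M →ₗ[Λ] P) →ₗ[K] K :=
    LinearMap.mk₂ K (fun f g => ν (i (g (f (p 1)))))
      (fun f f' g => by simp) (fun c f g => by
        rw [LinearMap.smul_apply, LinearMap.map_smul_of_tower, LinearMap.map_smul_of_tower,
          map_smul])
      (fun f g g' => by simp) (fun c f g => by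
        rw [LinearMap.smul_apply, LinearMap.map_smul_of_tower, map_smul])
  have hB1 : Function.Injective B := by
    refine (injective_iff_map_eq_zero B).2 fun f hf0 => ?_
    have hB : ∀ g : M →ₗ[Λ] P, ν (i (g (f (p 1)))) = 0 := fun g => LinearMap.congr_fun hf0 g
    have hw : f (p 1) = 0 := by
      by_contra hne
      obtain ⟨φ, hφ⟩ := Module.Projective.exists_dual_ne_zero K hne
      obtain ⟨G, hG⟩ := exists_linearMap_form_eq hl φ
      have h0 := hB (p ∘ₗ G)
      rw [LinearMap.comp_apply, hp, map_smul, smul_eq_mul, hν, ← smul_eq_mul, ← map_smul, ← hf,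
        ← hG] at h0
      exact hφ h0
    ext x
    rw [hf, hw, smul_zero, LinearMap.zero_apply]
  have hB2 : Function.Injective B.flip := by
    refine (injective_iff_map_eq_zero B.flip).2 fun g hg0 => ?_
    have hB : ∀ f : P →ₗ[Λ] M, ν (i (g (f (p 1)))) = 0 := fun f => LinearMap.congr_fun hg0 f
    have hz : ∀ m, ν (i (g m)) = 0 := fun m => by
      have := hB (LinearMap.toSpanSingleton Λ M m ∘ₗ i)
      rw [LinearMap.comp_apply, LinearMap.toSpanSingleton_apply, map_smul, map_smul, smul_eq_mul,
        hν, ← hi] at this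
      exact this
    ext m
    have : i (g m) = 0 := eq_zero_of_form hl fun a => by
      rw [← smul_eq_mul, ← map_smul, ← map_smul, hz]
    rw [hx (g m), this, zero_smul, LinearMap.zero_apply]
  refine le_antisymm ?_ ?_
  · exact (LinearMap.finrank_le_finrank_of_injective hB1).trans Subspace.dual_finrank_eq.le
  · exact (LinearMap.finrank_le_finrank_of_injective hB2).trans Subspace.dual_finrank_eq.le

end Symmetric

/-! ### Radical and socle -/

section Radical

variable {Λ : Type u} [Ring Λ] {M N : Type u} [AddCommGroup M] [Module Λ M] [AddCommGroup N]
  [Module Λ N]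

/-- The elements killed by the Jacobson radical of `Λ`. Over an Artinian ring this is the socle. -/
def socle (Λ : Type u) [Ring Λ] (M : Type u) [AddCommGroup M] [Module Λ M] : Submodule Λ M where
  carrier := {x | ∀ r ∈ Ring.jacobson Λ, r • x = 0}
  add_mem' hx hy r hr := by rw [smul_add, hx r hr, hy r hr, add_zero]
  zero_mem' r _ := smul_zero r
  smul_mem' a x hx r hr := by rw [smul_smul]; exact hx _ (Ideal.mul_mem_right a _ hr)

theorem map_mem_socle (f : M →ₗ[Λ] N) {x : M} (hx : x ∈ socle Λ M) : f x ∈ socle Λ N :=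
  fun r hr => by rw [← map_smul, hx r hr, map_zero]

theorem socle_eq_top_of_simple [IsSimpleModule Λ M] : socle Λ M = ⊤ :=
  eq_top_iff.2 fun x _ _ hr =>
    Module.mem_annihilator.1 (IsSemisimpleModule.jacobson_le_annihilator Λ M hr) x

theorem socle_socle : socle Λ (socle Λ M) = ⊤ :=
  eq_top_iff.2 fun x _ r hr => Subtype.ext (x.2 r hr)

theorem socle_quotient_jacobson :
    socle Λ (M ⧸ (Ring.jacobson Λ • ⊤ : Submodule Λ M)) = ⊤ := by
  refine eq_top_iff.2 fun x _ r hr => ?_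
  obtain ⟨x, rfl⟩ := Submodule.mkQ_surjective _ x
  rw [← map_smul, Submodule.mkQ_apply, Submodule.Quotient.mk_eq_zero]
  exact Submodule.smul_mem_smul hr trivial

/-- A linear map into a module killed by the radical `J` vanishes on `J M`. -/
theorem jacobson_smul_le_ker (hN : socle Λ N = ⊤) (f : M →ₗ[Λ] N) :
    Ring.jacobson Λ • ⊤ ≤ LinearMap.ker f :=
  Submodule.smul_le.2 fun r hr x _ => by
    rw [LinearMap.mem_ker, map_smul]
    exact (hN ▸ Submodule.mem_top : f x ∈ socle Λ N) r hr

theorem map_jacobson_smul_le (f : M →ₗ[Λ] N) {L : Submodule Λ M} {L' : Submodule Λ N}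
    (h : L.map f ≤ L') : (Ring.jacobson Λ • L).map f ≤ Ring.jacobson Λ • L' := by
  rw [Submodule.map_smul'']
  exact smul_mono_right _ h

theorem jacobson_smul_eq_bot_of_simple [IsSimpleModule Λ M] :
    (Ring.jacobson Λ • ⊤ : Submodule Λ M) = ⊥ :=
  le_bot_iff.1 (Submodule.smul_le.2 fun r hr x _ =>
    (socle_eq_top_of_simple (Λ := Λ) (M := M) ▸ Submodule.mem_top : x ∈ socle Λ M) r hr)

theorem exists_simple_quotient [Module.Finite Λ M] [Nontrivial M] :
    ∃ L : Submodule Λ M, IsSimpleModule Λ (M ⧸ L) := by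
  obtain ⟨L, hL, -⟩ := (eq_top_or_exists_le_coatom (⊥ : Submodule Λ M)).resolve_left bot_ne_top
  exact ⟨L, isSimpleModule_iff_isCoatom.2 hL⟩

theorem IsProjectiveCover.surjective_of_comp {P Q : Type u} [AddCommGroup P] [Module Λ P]
    [AddCommGroup Q] [Module Λ Q] {π : P →ₗ[Λ] M} (hπ : IsProjectiveCover π) (g : Q →ₗ[Λ] P)
    (h : Function.Surjective (π ∘ₗ g)) : Function.Surjective g := by
  refine LinearMap.range_eq_top.1 (hπ.superfluous _ (eq_top_iff.2 fun x _ => ?_))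
  obtain ⟨y, hy⟩ := h (π x)
  refine Submodule.mem_sup.2 ⟨x - g y, ?_, g y, ⟨y, rfl⟩, by abel⟩
  rw [LinearMap.mem_ker, map_sub, ← hy, LinearMap.comp_apply, sub_self]

variable [IsArtinianRing Λ]

theorem isSemisimpleModule_of_socle_eq_top (h : socle Λ M = ⊤) : IsSemisimpleModule Λ M := by
  have ht : Module.IsTorsionBySet Λ M (Ring.jacobson Λ) := fun x r =>
    (h ▸ Submodule.mem_top : x ∈ socle Λ M) r r.2
  let _ := ht.module
  exact (ht.semilinearMap.isSemisimpleModule_iff_of_bijective Function.bijective_id).2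
    inferInstance

theorem IsSuperfluous.le_jacobson_smul {L : Submodule Λ M} (h : IsSuperfluous L) :
    L ≤ Ring.jacobson Λ • ⊤ := by
  have := isSemisimpleModule_of_socle_eq_top (socle_quotient_jacobson (Λ := Λ) (M := M))
  refine le_trans ?_ (Module.jacobson_le_of_eq_bot (IsSemisimpleModule.jacobson_eq_bot Λ _))
  refine le_sInf fun m hm => ?_
  by_contra hle
  exact hm.1 (h m ((hm.2 _ (lt_of_le_of_ne le_sup_right fun he => hle (he ▸ le_sup_left)))))

/-- A map from a projective cover of `M` to a module killed by the radical factors through `M`. -/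
theorem IsProjectiveCover.homDim_eq (K : Type v) [Field K] [Algebra K Λ] {P : Type u}
    [AddCommGroup P] [Module Λ P] {π : P →ₗ[Λ] M} (hπ : IsProjectiveCover π)
    (hN : socle Λ N = ⊤) : homDim K Λ P N = homDim K Λ M N :=
  (homDim_eq_of_ker_le K π hπ.surjective fun f =>
    hπ.superfluous.le_jacobson_smul.trans (jacobson_smul_le_ker hN f)).symm

end Radical

/-- A symmetric algebra `Λ` with `J(Λ)^3 = 0`, together with a complete list of simple modules with
one-dimensional endomorphism rings and of their projective covers, such that the number of times
`S j` occurs in the top of `J (P i)` is `A i j`, and no vertex is isolated in the diagram with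
adjacency matrix `A`. -/
structure RadCubeZeroData (K : Type v) (Λ : Type u) [Field K] [Ring Λ] [Algebra K Λ]
    (ι : Type) [Fintype ι] [DecidableEq ι] (A : Matrix ι ι ℕ) where
  symm : IsSymmetricAlg K Λ
  cube : Ring.jacobson Λ ^ 3 = ⊥
  /-- the simple modules -/
  S : ι → ModuleCat.{u} Λ
  /-- the indecomposable projective modules -/
  P : ι → ModuleCat.{u} Λ
  /-- the projective covers -/
  π : ∀ i, P i →ₗ[Λ] S i
  simple : ∀ i, IsSimpleModule Λ (S i)
  complete : ∀ (T : Type u) [AddCommGroup T] [Module Λ T], IsSimpleModule Λ T →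
    ∃ i, Nonempty (T ≃ₗ[Λ] S i)
  homDim_S : ∀ i j, homDim K Λ (S i) (S j) = if i = j then 1 else 0
  cover : ∀ i, IsProjectiveCover (π i)
  homDim_rad : ∀ i j, homDim K Λ (Ring.jacobson Λ • ⊤ : Submodule Λ (P i)) (S j) = A i j
  not_isolated : ∀ i, ∃ j, j ≠ i ∧ A i j ≠ 0

namespace RadCubeZeroData

variable {K : Type v} {Λ : Type u} [Field K] [Ring Λ] [Algebra K Λ] {ι : Type} [Fintype ι]
  [DecidableEq ι] {A : Matrix ι ι ℕ} (D : RadCubeZeroData K Λ ι A)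

instance simple_S (i : ι) : IsSimpleModule Λ (D.S i) := D.simple i

instance finite_P (i : ι) : Module.Finite Λ (D.P i) := (D.cover i).finite

instance projective_P (i : ι) : Module.Projective Λ (D.P i) := (D.cover i).projective

include D in
theorem mul_mul_eq_zero {a b c : Λ} (ha : a ∈ Ring.jacobson Λ) (hb : b ∈ Ring.jacobson Λ)
    (hc : c ∈ Ring.jacobson Λ) : a * b * c = 0 := by
  have : a * b * c ∈ Ring.jacobson Λ ^ 3 := by
    rw [Submodule.pow_succ, Submodule.pow_succ, Submodule.pow_one]
    exact Ideal.mul_mem_mul (Ideal.mul_mem_mul ha hb) hc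
  rw [D.cube] at this
  exact this

include D in
theorem jacobson_sq_le_socle (M : Type u) [AddCommGroup M] [Module Λ M] :
    (Ring.jacobson Λ • Ring.jacobson Λ • ⊤ : Submodule Λ M) ≤ socle Λ M := by
  refine Submodule.smul_le.2 fun r hr x hx s hs => ?_
  rw [smul_smul]
  induction hx using Submodule.smul_induction_on' with
  | smul t ht y _ => rw [smul_smul, D.mul_mul_eq_zero hs hr ht, zero_smul]
  | add a _ b _ ha hb => rw [smul_add, ha, hb, add_zero]

/-- The projective cover of a simple module is a direct summand of `Λ`. -/
theorem exists_retract (i : ι) :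
    ∃ (s : D.P i →ₗ[Λ] Λ) (p : Λ →ₗ[Λ] D.P i), ∀ x, p (s x) = x := by
  have := IsSimpleModule.nontrivial Λ (D.S i)
  obtain ⟨x, hx⟩ := exists_ne (0 : D.S i)
  have hsurj := IsSimpleModule.toSpanSingleton_surjective Λ hx
  obtain ⟨p, hp⟩ := Module.projective_lifting_property (D.π i)
    (LinearMap.toSpanSingleton Λ (D.S i) x) (D.cover i).surjective
  have hps := (D.cover i).surjective_of_comp p (by rw [hp]; exact hsurj)
  obtain ⟨s, hs⟩ := Module.projective_lifting_property p LinearMap.id hps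
  exact ⟨s, p, fun x => LinearMap.congr_fun hs x⟩

theorem homDim_P_comm [Module.Finite K Λ] (M : Type u) [AddCommGroup M] [Module Λ M]
    [Module.Finite Λ M] (i : ι) : homDim K Λ (D.P i) M = homDim K Λ M (D.P i) := by
  obtain ⟨s, p, h⟩ := D.exists_retract i
  exact D.symm.homDim_comm s p h

variable [IsArtinianRing Λ]

theorem homDim_P_S (i j : ι) : homDim K Λ (D.P i) (D.S j) = if i = j then 1 else 0 := by
  rw [(D.cover i).homDim_eq K socle_eq_top_of_simple, D.homDim_S]

theorem ker_π (i : ι) : LinearMap.ker (D.π i) = Ring.jacobson Λ • ⊤ :=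
  le_antisymm (D.cover i).superfluous.le_jacobson_smul
    (jacobson_smul_le_ker socle_eq_top_of_simple _)

variable [Module.Finite K Λ]

variable (M : Type u) [AddCommGroup M] [Module Λ M] [Module.Finite Λ M]

/-- A finitely generated module without composition factors is zero. -/
theorem subsingleton_of_homDim_eq_zero (h : ∀ i, homDim K Λ (D.P i) M = 0) : Subsingleton M := by
  by_contra hne
  rw [not_subsingleton_iff_nontrivial] at hne
  obtain ⟨L, hL⟩ := exists_simple_quotient (Λ := Λ) (M := M)
  obtain ⟨i, ⟨e⟩⟩ := D.complete _ hL
  have h1 := homDim_add_quotient K (M := D.P i) L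
  rw [h i, homDim_congr_right K e, D.homDim_P_S, if_pos rfl] at h1
  omega

/-- A submodule with the same composition factors as the whole module is the whole module. -/
theorem eq_top_of_homDim_eq (L : Submodule Λ M)
    (h : ∀ i, homDim K Λ (D.P i) L = homDim K Λ (D.P i) M) : L = ⊤ := by
  have := D.subsingleton_of_homDim_eq_zero (M ⧸ L) fun i => by
    have := homDim_add_quotient K (M := D.P i) L
    rw [h] at this
    omega
  exact Submodule.Quotient.subsingleton_iff.1 this

/-- The indecomposable projective module `P i` has simple socle isomorphic to `S i`. -/
theorem exists_socle_P (i : ι) : ∃ s : D.S i →ₗ[Λ] D.P i, Function.Injective s ∧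
    LinearMap.range s = socle Λ (D.P i) := by
  have h1 : ∀ j, homDim K Λ (D.S j) (D.P i) = if j = i then 1 else 0 := fun j => by
    rw [← D.homDim_P_comm, D.homDim_P_S]
    simp only [eq_comm]
  obtain ⟨s, hs⟩ : ∃ s : D.S i →ₗ[Λ] D.P i, s ≠ 0 := by
    by_contra! hne
    have := h1 i
    rw [(homDim_eq_zero_iff K).2 hne, if_pos rfl] at this
    omega
  have hinj := s.injective_or_eq_zero.resolve_right hs
  have hmem : ∀ {j} (f : D.S j →ₗ[Λ] D.P i) x, f x ∈ socle Λ (D.P i) := fun f x =>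
    map_mem_socle f (by rw [socle_eq_top_of_simple]; trivial)
  let s' : D.S i →ₗ[Λ] socle Λ (D.P i) := s.codRestrict _ (hmem s)
  have hs' : Function.Injective s' := fun a b hab => hinj (congrArg Subtype.val hab)
  have htop : LinearMap.range s' = ⊤ := D.eq_top_of_homDim_eq _ _ fun j => by
    rw [← homDim_congr_right K (LinearEquiv.ofInjective s' hs'), D.homDim_P_S,
      (D.cover j).homDim_eq K socle_socle,
      homDim_eq_of_le_range K (socle Λ (D.P i)).subtype Subtype.val_injective, h1]
    rintro f _ ⟨x, rfl⟩
    rw [Submodule.range_subtype]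
    exact hmem f x
  refine ⟨s, hinj, ?_⟩
  have : s = (socle Λ (D.P i)).subtype ∘ₗ s' := rfl
  rw [this, LinearMap.range_comp, htop, Submodule.map_top, Submodule.range_subtype]

/-- In a module killed by the radical, the multiplicity of `S i` as a composition factor is its
multiplicity in the top. -/
theorem homDim_S_eq_of_socle_eq_top (h : socle Λ M = ⊤) (i : ι) :
    homDim K Λ M (D.S i) = homDim K Λ (D.P i) M := by
  obtain ⟨s, hs, hr⟩ := D.exists_socle_P i
  rw [D.homDim_P_comm, homDim_eq_of_le_range K s hs]
  rintro f _ ⟨x, rfl⟩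
  rw [hr]
  exact map_mem_socle f (h ▸ trivial)

theorem homDim_quotient_jacobson (i : ι) :
    homDim K Λ (D.P i) (M ⧸ (Ring.jacobson Λ • ⊤ : Submodule Λ M)) = homDim K Λ M (D.S i) := by
  rw [← D.homDim_S_eq_of_socle_eq_top _ socle_quotient_jacobson]
  refine homDim_eq_of_ker_le K _ (Submodule.mkQ_surjective _) fun f => ?_
  rw [Submodule.ker_mkQ]
  exact jacobson_smul_le_ker socle_eq_top_of_simple f

/-- The socle of `P i` is `J² P i`. Indeed `J² P i = 0` would make `J (P i)` simple, isomorphic to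
`S i`, so that the vertex `i` would be isolated. -/
theorem socle_P (i : ι) :
    (Ring.jacobson Λ • Ring.jacobson Λ • ⊤ : Submodule Λ (D.P i)) = socle Λ (D.P i) := by
  obtain ⟨s, hs, hr⟩ := D.exists_socle_P i
  have hle := D.jacobson_sq_le_socle (D.P i)
  have key : ∀ L : Submodule Λ (D.P i), L ≤ socle Λ (D.P i) → L = ⊥ ∨ L = socle Λ (D.P i) := by
    intro L hL
    have hL' : (L.comap s).map s = L := by
      rw [Submodule.map_comap_eq, hr, inf_eq_right.2 hL]
    rcases eq_bot_or_eq_top (L.comap s) with h | h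
    · left
      rw [← hL', h, Submodule.map_bot]
    · right
      rw [← hL', h, Submodule.map_top, hr]
  refine (key _ hle).resolve_left fun h0 => ?_
  obtain ⟨j, hji, hA⟩ := D.not_isolated i
  rw [← D.homDim_rad i j] at hA
  have hsub : (Ring.jacobson Λ • ⊤ : Submodule Λ (D.P i)) ≤ socle Λ (D.P i) := fun x hx r hr => by
    have : r • x ∈ (Ring.jacobson Λ • Ring.jacobson Λ • ⊤ : Submodule Λ (D.P i)) :=
      Submodule.smul_mem_smul hr hx
    rw [h0] at this
    exact this
  rcases key _ hsub with h | h
  · rw [h] at hA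
    exact hA (homDim_eq_zero_of_subsingleton K)
  · rw [h, ← hr, ← homDim_congr_left K (LinearEquiv.ofInjective s hs), D.homDim_S,
      if_neg hji.symm] at hA
    exact hA rfl

end RadCubeZeroData

namespace RadCubeZeroData

variable {K : Type v} {Λ : Type u} [Field K] [Ring Λ] [Algebra K Λ] {ι : Type} [Fintype ι]
  [DecidableEq ι] {A : Matrix ι ι ℕ} (D : RadCubeZeroData K Λ ι A)

/-- A nonzero finitely generated projective module splits off some `P i`. -/
theorem exists_prod_equiv (X : Type u) [AddCommGroup X] [Module Λ X] [Module.Finite Λ X]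
    [Module.Projective Λ X] [Nontrivial X] :
    ∃ (i : ι) (Y : Submodule Λ X), Module.Projective Λ Y ∧ Nonempty ((Y × D.P i) ≃ₗ[Λ] X) := by
  obtain ⟨L, hL⟩ := exists_simple_quotient (Λ := Λ) (M := X)
  obtain ⟨i, ⟨e⟩⟩ := D.complete _ hL
  obtain ⟨g, hg⟩ := Module.projective_lifting_property (D.π i) (e.toLinearMap ∘ₗ L.mkQ)
    (D.cover i).surjective
  have hgs := (D.cover i).surjective_of_comp g (by
    rw [hg]
    exact e.surjective.comp L.mkQ_surjective)
  obtain ⟨s, hs⟩ := Module.projective_lifting_property g LinearMap.id hgs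
  have hs' : ∀ x, g (s x) = x := fun x => LinearMap.congr_fun hs x
  let f : (LinearMap.ker g × D.P i) →ₗ[Λ] X := (LinearMap.ker g).subtype.coprod s
  have hf : Function.Bijective f := by
    constructor
    · refine (injective_iff_map_eq_zero f).2 ?_
      rintro ⟨⟨a, ha⟩, b⟩ h
      have h' : a + s b = 0 := h
      have hb : b = 0 := by
        have := congrArg g h'
        rwa [map_add, LinearMap.mem_ker.1 ha, hs', zero_add, map_zero] at this
      subst hb
      rw [map_zero, add_zero] at h'
      subst h'
      rfl
    · intro x
      refine ⟨(⟨x - s (g x), by rw [LinearMap.mem_ker, map_sub, hs', sub_self]⟩, g x), ?_⟩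
      change x - s (g x) + s (g x) = x
      abel
  let F := LinearEquiv.ofBijective f hf
  refine ⟨i, LinearMap.ker g, ?_, ⟨F⟩⟩
  refine Module.Projective.of_split (LinearMap.ker g).subtype
    (LinearMap.fst Λ _ _ ∘ₗ F.symm.toLinearMap) ?_
  ext x
  have : F.symm ((LinearMap.ker g).subtype x) = (x, 0) := by
    rw [LinearEquiv.symm_apply_eq]
    change _ = (x : X) + s 0
    rw [map_zero, add_zero]
    rfl
  simp only [LinearMap.comp_apply, LinearEquiv.coe_coe, this]
  rfl

variable [Module.Finite K Λ] [IsArtinianRing Λ]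

/-- The values on a projective module `X` with top multiplicities `t` are those on the sum of the
`P l` with multiplicities `t l`. -/
theorem homDim_projective (X : Type u) [AddCommGroup X] [Module Λ X] [Module.Finite Λ X]
    [Module.Projective Λ X] : (∀ j, homDim K Λ (D.S j) X = homDim K Λ X (D.S j)) ∧
    ∀ (M : Type u) [AddCommGroup M] [Module Λ M] [Module.Finite Λ M],
      homDim K Λ X M = ∑ l, homDim K Λ X (D.S l) * homDim K Λ (D.P l) M := by
  obtain ⟨n, hn⟩ := ENat.ne_top_iff_exists.1 (Module.length_ne_top (R := Λ) (M := X))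
  induction n using Nat.strong_induction_on generalizing X with
  | _ n ih =>
  rcases subsingleton_or_nontrivial X with hX | hX
  · constructor
    · intro j
      rw [homDim_eq_zero_of_subsingleton_right, homDim_eq_zero_of_subsingleton]
    · intro M _ _ _
      rw [homDim_eq_zero_of_subsingleton, eq_comm]
      exact Finset.sum_eq_zero fun l _ => by rw [homDim_eq_zero_of_subsingleton, zero_mul]
  obtain ⟨i, Y, hY, ⟨e⟩⟩ := D.exists_prod_equiv X
  have hlt : Module.length Λ Y < Module.length Λ X := by
    refine Submodule.length_lt fun htop => ?_
    have hlen := e.length_eq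
    rw [Module.length_prod, htop, Module.length_top] at hlen
    have : Nontrivial (D.P i) := by
      have := IsSimpleModule.nontrivial Λ (D.S i)
      exact (D.cover i).surjective.nontrivial
    have h0 : Module.length Λ (D.P i) = 0 := by
      rw [← hn] at hlen
      obtain ⟨m, hm⟩ := ENat.ne_top_iff_exists.1 (Module.length_ne_top (R := Λ) (M := D.P i))
      rw [← hm] at hlen ⊢
      norm_cast at hlen ⊢
      omega
    exact (Module.length_pos (R := Λ) (M := D.P i)).ne' h0
  obtain ⟨m, hm⟩ := ENat.ne_top_iff_exists.1 hlt.ne_top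
  rw [← hm, ← hn] at hlt
  obtain ⟨h1, h2⟩ := ih m (by exact_mod_cast hlt) Y hm
  have hl : ∀ (M : Type u) [AddCommGroup M] [Module Λ M] [Module.Finite Λ M],
      homDim K Λ X M = homDim K Λ Y M + homDim K Λ (D.P i) M := fun M _ _ _ => by
    rw [← homDim_congr_left K e, homDim_prod_left]
  constructor
  · intro j
    rw [hl, ← homDim_congr_right K e, homDim_prod_right, h1, ← D.homDim_P_comm]
  · intro M _ _ _
    simp only [hl, h2 M, add_mul, Finset.sum_add_distrib, D.homDim_P_S]
    simp

include D in
/-- The socle of a finitely generated projective module `X` is `J² X`: an embedding of `S j` into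
the injective module `X` extends to `P j`, and `S j = J² P j` inside `P j`. -/
theorem socle_projective (X : Type u) [AddCommGroup X] [Module Λ X] [Module.Finite Λ X]
    [Module.Projective Λ X] :
    (Ring.jacobson Λ • Ring.jacobson Λ • ⊤ : Submodule Λ X) = socle Λ X := by
  set V : Submodule Λ X := Ring.jacobson Λ • Ring.jacobson Λ • ⊤
  have hV : V ≤ socle Λ X := D.jacobson_sq_le_socle X
  have := D.symm.injective_of_projective X
  have himg : ∀ {j} (f : D.S j →ₗ[Λ] X), LinearMap.range f ≤ V := by
    rintro j f _ ⟨x, rfl⟩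
    obtain ⟨s, hs, hr⟩ := D.exists_socle_P j
    obtain ⟨h, hh⟩ := this.out s hs f
    rw [← hh]
    have hx : s x ∈ (Ring.jacobson Λ • Ring.jacobson Λ • ⊤ : Submodule Λ (D.P j)) := by
      rw [D.socle_P, ← hr]
      exact ⟨x, rfl⟩
    exact map_jacobson_smul_le h (map_jacobson_smul_le h le_top) ⟨_, hx, rfl⟩
  have hdim : ∀ L : Submodule Λ X, V ≤ L → L ≤ socle Λ X → ∀ j,
      homDim K Λ (D.P j) L = homDim K Λ (D.S j) X := fun L h1 h2 j => by
    have hL : socle Λ L = ⊤ := eq_top_iff.2 fun x _ r hr => Subtype.ext (h2 x.2 r hr)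
    rw [(D.cover j).homDim_eq K hL,
      homDim_eq_of_le_range K L.subtype Subtype.val_injective]
    intro f
    rw [Submodule.range_subtype]
    exact (himg f).trans h1
  have htop := D.eq_top_of_homDim_eq (socle Λ X) (V.comap (socle Λ X).subtype) fun j => by
    rw [homDim_congr_right K (Submodule.comapSubtypeEquivOfLe hV), hdim V le_rfl hV,
      hdim _ hV le_rfl]
  refine le_antisymm hV fun x hx => ?_
  have : (⟨x, hx⟩ : socle Λ X) ∈ V.comap (socle Λ X).subtype := htop ▸ trivial
  exact this

/-- The composition factors of a projective module with top multiplicities `t` are given by the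
vector `2 t + A t`. -/
theorem homDim_P_projective (X : Type u) [AddCommGroup X] [Module Λ X] [Module.Finite Λ X]
    [Module.Projective Λ X] (j : ι) :
    homDim K Λ (D.P j) X =
      2 * homDim K Λ X (D.S j) + ∑ l, A j l * homDim K Λ X (D.S l) := by
  let R : Submodule Λ (D.P j) := Ring.jacobson Λ • ⊤
  have h1 : homDim K Λ X (D.P j) = homDim K Λ X R + homDim K Λ X (D.S j) := by
    rw [homDim_add K (D.π j) (D.cover j).surjective,
      homDim_congr_right K (LinearEquiv.ofEq _ _ (D.ker_π j))]
  have h2 := homDim_add_quotient K (M := X) (Ring.jacobson Λ • ⊤ : Submodule Λ R)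
  have h3 : homDim K Λ X (Ring.jacobson Λ • ⊤ : Submodule Λ R) = homDim K Λ X (D.S j) := by
    obtain ⟨s, hs, hr⟩ := D.exists_socle_P j
    have hmap : (Ring.jacobson Λ • ⊤ : Submodule Λ R).map R.subtype = LinearMap.range s := by
      rw [Submodule.map_smul'', Submodule.map_top, Submodule.range_subtype, hr, ← D.socle_P]
    rw [homDim_congr_right K
      ((Submodule.equivMapOfInjective R.subtype Subtype.val_injective _).trans
      ((LinearEquiv.ofEq _ _ hmap).trans (LinearEquiv.ofInjective s hs).symm))]
  have h4 : homDim K Λ X (R ⧸ (Ring.jacobson Λ • ⊤ : Submodule Λ R)) =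
      ∑ l, A j l * homDim K Λ X (D.S l) := by
    rw [(D.homDim_projective X).2]
    refine Finset.sum_congr rfl fun l _ => ?_
    rw [D.homDim_quotient_jacobson, D.homDim_rad, mul_comm]
  rw [D.homDim_P_comm, h1, h2, h3, h4]
  omega

/-- Every endomorphism is nilpotent or bijective. For modules of finite length this is
indecomposability, by Fitting's lemma. -/
def EndNilpotentOrBijective (Λ : Type u) [Ring Λ] (M : Type u) [AddCommGroup M] [Module Λ M] :
    Prop :=
  ∀ f : Module.End Λ M, IsNilpotent f ∨ Function.Bijective f

variable {M P : Type u} [AddCommGroup M] [Module Λ M] [AddCommGroup P] [Module Λ P]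
  [Module.Finite Λ M]

include D in
/-- Over a self-injective algebra, indecomposability passes to syzygies: an endomorphism of
`Ω M ⊆ P` extends to `P` and induces an endomorphism of `M`. -/
theorem endNilpotentOrBijective_ker {π : P →ₗ[Λ] M} (hπ : IsProjectiveCover π)
    (hM : EndNilpotentOrBijective Λ M) : EndNilpotentOrBijective Λ (LinearMap.ker π) := by
  intro f
  have := hπ.projective
  have := hπ.finite
  obtain ⟨F, hF⟩ := (D.symm.injective_of_projective P).out (LinearMap.ker π).subtype
    Subtype.val_injective ((LinearMap.ker π).subtype ∘ₗ f)
  have hF' : ∀ x : LinearMap.ker π, F (x : P) = f x := hF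
  obtain ⟨G, hG⟩ := exists_comp_eq_of_ker_le π hπ.surjective (π ∘ₗ F) fun x hx => by
    have := hF' ⟨x, hx⟩
    rw [LinearMap.mem_ker, LinearMap.comp_apply, this]
    exact (f ⟨x, hx⟩).2
  have hG' : ∀ x, G (π x) = π (F x) := fun x => LinearMap.congr_fun hG x
  rcases hM G with ⟨m, hm⟩ | hb
  · left
    have hpow : ∀ k x, (G ^ k) (π x) = π ((F ^ k) x) := by
      intro k
      induction k with
      | zero => simp
      | succ k ih =>
        intro x
        rw [pow_succ, pow_succ, Module.End.mul_apply, Module.End.mul_apply, hG', ih]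
    have hfpow : ∀ k x, (((f ^ k) x : LinearMap.ker π) : P) = (F ^ k) x := by
      intro k
      induction k with
      | zero => simp
      | succ k ih =>
        intro x
        rw [pow_succ, pow_succ, Module.End.mul_apply, Module.End.mul_apply, ih, hF']
    have h1 : Submodule.map (F ^ m) ⊤ ≤ Ring.jacobson Λ • ⊤ := by
      refine le_trans ?_ hπ.superfluous.le_jacobson_smul
      rintro _ ⟨x, -, rfl⟩
      rw [LinearMap.mem_ker, ← hpow, hm, LinearMap.zero_apply]
    refine ⟨m + (m + m), LinearMap.ext fun x => Subtype.ext ?_⟩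
    rw [hfpow, pow_add, pow_add, Module.End.mul_apply, Module.End.mul_apply]
    have h2 := map_jacobson_smul_le (F ^ m) h1
    have h3 := map_jacobson_smul_le (F ^ m) h2
    have hx : (F ^ m) ((F ^ m) ((F ^ m) (x : P))) ∈
        (Ring.jacobson Λ • Ring.jacobson Λ • Ring.jacobson Λ • ⊤ : Submodule Λ P) :=
      h3 ⟨_, h2 ⟨_, h1 ⟨_, trivial, rfl⟩, rfl⟩, rfl⟩
    have hbot : (Ring.jacobson Λ • Ring.jacobson Λ • Ring.jacobson Λ • ⊤ : Submodule Λ P) ≤ ⊥ := by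
      refine Submodule.smul_le.2 fun r hr y hy => ?_
      have hy' : y ∈ (Ring.jacobson Λ • Ring.jacobson Λ • ⊤ : Submodule Λ P) := hy
      exact D.jacobson_sq_le_socle P hy' r hr
    exact hbot hx
  · right
    have hFs : Function.Surjective F := by
      refine hπ.surjective_of_comp F fun y => ?_
      obtain ⟨z, rfl⟩ := hb.2 y
      obtain ⟨x, rfl⟩ := hπ.surjective z
      exact ⟨x, (hG' x).symm⟩
    have hFi := IsNoetherian.injective_of_surjective_endomorphism F hFs
    refine IsArtinian.bijective_of_injective_endomorphism f fun a b hab => ?_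
    refine Subtype.ext (hFi ?_)
    rw [hF', hF', hab]

end RadCubeZeroData

namespace RadCubeZeroData

variable {K : Type v} {Λ : Type u} [Field K] [Ring Λ] [Algebra K Λ] {ι : Type} [Fintype ι]
  [DecidableEq ι] {A : Matrix ι ι ℕ} (D : RadCubeZeroData K Λ ι A)

/-- The invariant carried along a sequence of syzygies: `M` is nonzero, finitely generated and
indecomposable, `J² M = 0`, and the composition factors of `M` are those of its top together with
those given by the vector `r`. -/
structure HasRadicalVector (M : Type u) [AddCommGroup M] [Module Λ M] (r : ι → ℕ) : Prop where
  finite : Module.Finite Λ M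
  nontrivial : Nontrivial M
  endo : EndNilpotentOrBijective Λ M
  sq : (Ring.jacobson Λ • Ring.jacobson Λ • ⊤ : Submodule Λ M) = ⊥
  dim : ∀ j, homDim K Λ (D.P j) M = homDim K Λ M (D.S j) + r j

theorem hasRadicalVector_of_simple [Module.Finite K Λ] [IsArtinianRing Λ] (i : ι) :
    D.HasRadicalVector (D.S i) 0 where
  finite := inferInstance
  nontrivial := IsSimpleModule.nontrivial Λ _
  endo f := f.bijective_or_eq_zero.symm.imp_left fun h => ⟨1, by rw [h, pow_one]⟩
  sq := by rw [jacobson_smul_eq_bot_of_simple, Submodule.smul_bot]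
  dim j := by
    rw [D.homDim_S_eq_of_socle_eq_top (D.S i) socle_eq_top_of_simple, Pi.zero_apply, add_zero]

variable [IsArtinianRing Λ] {N : Type u} [AddCommGroup N] [Module Λ N] [Module.Finite Λ N]

/-- If the socle of an indecomposable module `N` is not contained in `J N`, then `N` is simple:
a simple submodule of `N` that is not contained in `J N` is a direct summand. -/
theorem exists_equiv_of_not_socle_le (hN : EndNilpotentOrBijective Λ N)
    (h : ¬ socle Λ N ≤ Ring.jacobson Λ • ⊤) : ∃ i, Nonempty (N ≃ₗ[Λ] D.S i) := by
  set q := (Ring.jacobson Λ • ⊤ : Submodule Λ N).mkQ with hq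
  set V := (socle Λ N).map q with hV
  have hss := isSemisimpleModule_of_socle_eq_top (socle_quotient_jacobson (Λ := Λ) (M := N))
  have hne : V ≠ ⊥ := fun h0 => h fun x hx => by
    have : q x ∈ V := ⟨x, hx, rfl⟩
    rw [h0, Submodule.mem_bot, hq, Submodule.mkQ_apply, Submodule.Quotient.mk_eq_zero] at this
    exact this
  have := (Submodule.nontrivial_iff_ne_bot).2 hne
  obtain ⟨L, hL⟩ := exists_simple_quotient (Λ := Λ) (M := V)
  obtain ⟨i, ⟨e⟩⟩ := D.complete _ hL
  obtain ⟨C, hC⟩ := exists_isCompl V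
  -- `g` is a map onto `S i` whose restriction to the socle is still onto
  let g : N →ₗ[Λ] D.S i := e.toLinearMap ∘ₗ L.mkQ ∘ₗ V.projectionOnto C hC ∘ₗ q
  have hgs : Function.Surjective (g ∘ₗ (socle Λ N).subtype) := fun y => by
    obtain ⟨⟨_, x, hx, rfl⟩, hz⟩ := L.mkQ_surjective (e.symm y)
    refine ⟨⟨x, hx⟩, ?_⟩
    have : V.projectionOnto C hC (q x) = ⟨q x, x, hx, rfl⟩ :=
      Submodule.projectionOnto_apply_left hC ⟨q x, x, hx, rfl⟩
    change e (L.mkQ (V.projectionOnto C hC (q x))) = y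
    rw [this]
    exact (congrArg e hz).trans (e.apply_symm_apply y)
  -- lift `P i → S i` to the socle of `N`; the lift factors through `S i`
  obtain ⟨k, hk⟩ := Module.projective_lifting_property _ (D.π i) hgs
  obtain ⟨k', hk'⟩ := exists_comp_eq_of_ker_le (D.π i) (D.cover i).surjective k (by
    rw [D.ker_π]
    exact jacobson_smul_le_ker socle_socle k)
  have hgk : ∀ y, g (k' y) = y := fun y => by
    obtain ⟨x, rfl⟩ := (D.cover i).surjective y
    have h1 : k' (D.π i x) = k x := LinearMap.congr_fun hk' x
    rw [h1]
    exact LinearMap.congr_fun hk x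
  have hgsurj : Function.Surjective g := fun y => ⟨k' y, hgk y⟩
  let f : Module.End Λ N := (socle Λ N).subtype ∘ₗ k' ∘ₗ g
  have hff : IsIdempotentElem f := LinearMap.ext fun x => by
    change ((k' (g (k' (g x))) : socle Λ N) : N) = k' (g x)
    rw [hgk]
  rcases hN f with hf | hf
  · exfalso
    have h0 : f = 0 := by
      obtain ⟨n, hn⟩ := hf
      rcases Nat.eq_zero_or_pos n with rfl | hpos
      · have : (1 : Module.End Λ N) = 0 := by rw [← hn, pow_zero]
        rw [← one_mul f, this, zero_mul]
      · rw [← hff.pow_eq hpos.ne', hn]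
    have := IsSimpleModule.nontrivial Λ (D.S i)
    obtain ⟨y, hy⟩ := exists_ne (0 : D.S i)
    obtain ⟨x, rfl⟩ := hgsurj y
    have hx : ((k' (g x) : socle Λ N) : N) = 0 := LinearMap.congr_fun h0 x
    rw [← hgk (g x), hx, map_zero] at hy
    exact hy rfl
  · refine ⟨i, ⟨LinearEquiv.ofBijective g ⟨fun a b hab => hf.1 ?_, hgsurj⟩⟩⟩
    change ((k' (g a) : socle Λ N) : N) = k' (g b)
    rw [hab]

variable [Module.Finite K Λ] {M P : Type u} [AddCommGroup M] [Module Λ M] [AddCommGroup P]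
  [Module Λ P]

/-- Passing to a syzygy. Let `t` be the vector of top multiplicities of `M` and `r` that of the
remaining composition factors. Either the syzygy is not simple, and its vectors are `A t - r`
and `t`, or it is some `S s`, in which case `t` is the basis vector at `s` and `A t - r = 0`. -/
theorem HasRadicalVector.step {r : ι → ℕ} (hM : D.HasRadicalVector M r) {π : P →ₗ[Λ] M}
    (hπ : IsProjectiveCover π) :
    (∃ s, Nonempty (LinearMap.ker π ≃ₗ[Λ] D.S s) ∧ ∀ j,
      homDim K Λ M (D.S j) = (if j = s then 1 else 0) ∧
      ∑ l, A j l * homDim K Λ M (D.S l) = r j) ∨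
    (¬ IsSimpleModule Λ (LinearMap.ker π) ∧
      D.HasRadicalVector (LinearMap.ker π) (fun j => homDim K Λ M (D.S j)) ∧ ∀ j,
      homDim K Λ (LinearMap.ker π) (D.S j) + r j = ∑ l, A j l * homDim K Λ M (D.S l)) := by
  have := hM.finite
  have := hM.nontrivial
  have := hπ.finite
  have := hπ.projective
  set N := LinearMap.ker π
  have htP : ∀ j, homDim K Λ P (D.S j) = homDim K Λ M (D.S j) := fun j =>
    hπ.homDim_eq K socle_eq_top_of_simple
  have hend := D.endNilpotentOrBijective_ker hπ hM.endo
  have hcN : ∀ j, homDim K Λ (D.P j) N + r j =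
      homDim K Λ M (D.S j) + ∑ l, A j l * homDim K Λ M (D.S l) := fun j => by
    have h1 : _ = homDim K Λ (D.P j) N + _ := homDim_add K (M := D.P j) π hπ.surjective
    have h2 := D.homDim_P_projective P j
    simp only [htP] at h2
    have h3 := hM.dim j
    omega
  have hsoc : socle Λ P ≤ N := by
    rw [← D.socle_projective]
    intro x hx
    have : π x ∈ (Ring.jacobson Λ • Ring.jacobson Λ • ⊤ : Submodule Λ M) :=
      map_jacobson_smul_le π (map_jacobson_smul_le π le_top) ⟨x, hx, rfl⟩
    rw [hM.sq] at this
    exact this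
  have hNrad : N ≤ Ring.jacobson Λ • ⊤ := hπ.superfluous.le_jacobson_smul
  have hJN : (Ring.jacobson Λ • ⊤ : Submodule Λ N) ≤ socle Λ N :=
    Submodule.smul_le.2 fun a ha x _ b hb => Subtype.ext
      (D.jacobson_sq_le_socle P (Submodule.smul_mem_smul ha (hNrad x.2)) b hb)
  have hcV : ∀ j, homDim K Λ (D.P j) (socle Λ N) = homDim K Λ M (D.S j) := fun j => by
    rw [(D.cover j).homDim_eq K socle_socle, ← htP, ← (D.homDim_projective P).1]
    refine homDim_eq_of_le_range K (N.subtype ∘ₗ (socle Λ N).subtype)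
      (Subtype.val_injective.comp Subtype.val_injective) ?_
    rintro f _ ⟨x, rfl⟩
    have hx : f x ∈ socle Λ P := map_mem_socle f (by rw [socle_eq_top_of_simple]; trivial)
    exact ⟨⟨⟨f x, hsoc hx⟩, fun a ha => Subtype.ext (hx a ha)⟩, rfl⟩
  have hsimple : (∃ s, Nonempty (N ≃ₗ[Λ] D.S s)) → (∃ s, Nonempty (N ≃ₗ[Λ] D.S s) ∧ ∀ j,
      homDim K Λ M (D.S j) = (if j = s then 1 else 0) ∧
      ∑ l, A j l * homDim K Λ M (D.S l) = r j) := by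
    rintro ⟨s, ⟨e⟩⟩
    have : IsSimpleModule Λ N := IsSimpleModule.congr e
    have hN : ∀ j, homDim K Λ (D.P j) N = if j = s then 1 else 0 := fun j => by
      rw [homDim_congr_right K e, D.homDim_P_S]
    have hV : ∀ j, homDim K Λ (D.P j) (socle Λ N) = homDim K Λ (D.P j) N := fun j => by
      rw [socle_eq_top_of_simple]
      exact homDim_congr_right K Submodule.topEquiv
    refine ⟨s, ⟨e⟩, fun j => ?_⟩
    have h1 := hcN j
    have h2 := hcV j
    rw [hV, hN] at h2
    rw [hN] at h1
    exact ⟨h2.symm, by omega⟩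
  by_cases hs : ∃ s, Nonempty (N ≃ₗ[Λ] D.S s)
  · exact Or.inl (hsimple hs)
  right
  have hle : socle Λ N ≤ Ring.jacobson Λ • ⊤ := by
    by_contra h
    exact hs (D.exists_equiv_of_not_socle_le hend h)
  have heq := le_antisymm hJN hle
  have hdimN : ∀ j, homDim K Λ (D.P j) N = homDim K Λ N (D.S j) + homDim K Λ M (D.S j) :=
    fun j => by
    rw [homDim_add_quotient K (Ring.jacobson Λ • ⊤ : Submodule Λ N), D.homDim_quotient_jacobson,
      heq, hcV, add_comm]
  refine ⟨fun h => hs (D.complete _ h), ⟨inferInstance, ?_, hend, ?_, hdimN⟩, fun j => ?_⟩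
  · by_contra hne
    rw [not_nontrivial_iff_subsingleton] at hne
    refine not_subsingleton M (D.subsingleton_of_homDim_eq_zero _ fun j => ?_)
    have h0 : ∀ j, homDim K Λ M (D.S j) = 0 := fun j => by
      rw [← hcV]
      exact homDim_eq_zero_of_subsingleton_right K
    have h1 := hcN j
    rw [homDim_eq_zero_of_subsingleton_right] at h1
    simp only [h0, mul_zero, Finset.sum_const_zero] at h1
    rw [hM.dim, h0]
    omega
  · rw [heq, ← le_bot_iff]
    exact Submodule.smul_le.2 fun a ha x hx => hx a ha
  · have h1 := hcN j
    rw [hdimN] at h1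
    omega

end RadCubeZeroData

/-! ### Chebyshev polynomials of adjacency matrices -/

section Chebyshev

variable {ι : Type} [Fintype ι] [DecidableEq ι]

/-- The value `S_k(A)` of the Chebyshev polynomial given by `S_0 = 1`, `S_1 = X` and
`S_(k + 1) = X S_k - S_(k - 1)` at the matrix `A`, as an integer matrix. -/
def chebyshevMatrix (A : Matrix ι ι ℕ) (k : ℤ) : Matrix ι ι ℤ :=
  Polynomial.aeval (A.map (Nat.cast : ℕ → ℤ)) (Polynomial.Chebyshev.S ℤ k)

variable (A : Matrix ι ι ℕ)

theorem chebyshevMatrix_zero : chebyshevMatrix A 0 = 1 := by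
  simp [chebyshevMatrix]

theorem chebyshevMatrix_neg_one : chebyshevMatrix A (-1) = 0 := by
  simp [chebyshevMatrix]

theorem chebyshevMatrix_add_one (k : ℤ) : chebyshevMatrix A (k + 1) =
    A.map (Nat.cast : ℕ → ℤ) * chebyshevMatrix A k - chebyshevMatrix A (k - 1) := by
  simp [chebyshevMatrix, Polynomial.Chebyshev.S_add_one]

theorem chebyshevMatrix_comm (k l : ℤ) :
    chebyshevMatrix A k * chebyshevMatrix A l = chebyshevMatrix A l * chebyshevMatrix A k := by
  rw [chebyshevMatrix, chebyshevMatrix, ← map_mul, ← map_mul, mul_comm]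

theorem chebyshevMatrix_one : chebyshevMatrix A 1 = A.map (Nat.cast : ℕ → ℤ) := by
  simp [chebyshevMatrix]

theorem chebyshevMatrix_sq {k : ℤ} (h : chebyshevMatrix A (k + 1) = 0) :
    chebyshevMatrix A k * chebyshevMatrix A k = 1 := by
  have := congrArg (Polynomial.aeval (A.map (Nat.cast : ℕ → ℤ)))
    (Polynomial.Chebyshev.S_sq_add_S_sq ℤ k)
  simp only [map_sub, map_add, map_pow, map_mul, map_one] at this
  change chebyshevMatrix A k ^ 2 + chebyshevMatrix A (k + 1) ^ 2 -
    _ * chebyshevMatrix A k * chebyshevMatrix A (k + 1) = 1 at this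
  rw [h, mul_zero, sub_zero, zero_pow two_ne_zero, add_zero, sq] at this
  exact this

/-- A diagram is connected if no proper nonempty set of vertices is closed under passing to
neighbours. -/
def IsConnectedDiagram {ι : Type} (A : Matrix ι ι ℕ) : Prop :=
  ∀ Z : ι → Prop, (∃ i, Z i) → (∀ i j, Z i → A i j ≠ 0 → Z j) → ∀ i, Z i

/-- The first index at which the sequence of columns `S_k(A) e_i` vanishes is `m`. -/
def FirstZeroAt (A : Matrix ι ι ℕ) (i : ι) (m : ℕ) : Prop :=
  (∀ k < m, (chebyshevMatrix A k).col i ≠ 0) ∧ (chebyshevMatrix A m).col i = 0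

end Chebyshev

/-! ### Syzygies of simple modules -/

namespace RadCubeZeroData

variable {K : Type v} {Λ : Type u} [Field K] [Ring Λ] [Algebra K Λ] {ι : Type} [Fintype ι]
  [DecidableEq ι] {A : Matrix ι ι ℕ} (D : RadCubeZeroData K Λ ι A)

include D in
theorem eq_of_equiv {i j : ι} (e : D.S i ≃ₗ[Λ] D.S j) : i = j := by
  by_contra hne
  have h := homDim_congr_right K (M := D.S i) e
  rw [D.homDim_S, D.homDim_S, if_pos rfl, if_neg hne] at h
  omega

theorem exists_homDim_S_ne_zero [Module.Finite K Λ] (M : Type u) [AddCommGroup M]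
    [Module Λ M] [Module.Finite Λ M] [Nontrivial M] : ∃ j, homDim K Λ M (D.S j) ≠ 0 := by
  obtain ⟨L, hL⟩ := exists_simple_quotient (Λ := Λ) (M := M)
  obtain ⟨j, ⟨e⟩⟩ := D.complete _ hL
  refine ⟨j, fun h => ?_⟩
  have h0 := (homDim_eq_zero_iff K).1 h (e.toLinearMap ∘ₗ L.mkQ)
  have := IsSimpleModule.nontrivial Λ (D.S j)
  obtain ⟨y, hy⟩ := exists_ne (0 : D.S j)
  obtain ⟨x, rfl⟩ := (e.surjective.comp L.mkQ_surjective) y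
  exact hy (LinearMap.congr_fun h0 x)

theorem repeatAfter_iff [IsArtinianRing Λ] {q : ℕ} (hq : 0 < q) :
    SimpleResolutionsRepeatAfter Λ q ↔ ∀ i, IsSyzygy q (D.S i) (D.S i) := by
  constructor
  · intro h i
    obtain ⟨⟨P, hP⟩, hr⟩ := h (D.S i) (D.simple i)
    exact (hP.repeatsAfter_iff P hq).1 (hr P hP)
  · intro h T hT
    refine ⟨exists_isMinimalResolution T, fun P hP => (hP.repeatsAfter_iff P hq).2 ?_⟩
    obtain ⟨i, ⟨e⟩⟩ := D.complete T hT
    have h0 : IsSyzygy (0 + q) T (D.S i) := (IsSyzygy.zero e).add (h i)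
    rw [zero_add] at h0
    exact h0.trans_equiv e.symm

variable [Module.Finite K Λ] [IsArtinianRing Λ]

theorem sum_sub_eq_chebyshevMatrix {t r : ι → ℕ} {k : ℤ} {i : ι}
    (ht : ∀ j, (t j : ℤ) = chebyshevMatrix A k j i)
    (hr : ∀ j, (r j : ℤ) = chebyshevMatrix A (k - 1) j i) (j : ι) :
    ((∑ l, A j l * t l : ℕ) : ℤ) - r j = chebyshevMatrix A (k + 1) j i := by
  rw [chebyshevMatrix_add_one, Matrix.sub_apply, Matrix.mul_apply, hr]
  push_cast
  simp [ht]

/-- As long as the columns `S_0(A) e_i, …, S_k(A) e_i` do not vanish, the last two of them are the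
vectors of the `k`-th syzygy of `S i`, which is not simple for `k > 0`. -/
theorem exists_syzygy (i : ι) (k : ℕ) (hk : ∀ k' ≤ k, (chebyshevMatrix A k').col i ≠ 0) :
    ∃ (M : ModuleCat.{u} Λ) (r : ι → ℕ), IsSyzygy k (D.S i) M ∧ D.HasRadicalVector M r ∧
      (∀ j, (homDim K Λ M (D.S j) : ℤ) = chebyshevMatrix A k j i) ∧
      (∀ j, (r j : ℤ) = chebyshevMatrix A (k - 1) j i) ∧ (0 < k → ¬ IsSimpleModule Λ M) := by
  induction k with
  | zero =>
    refine ⟨D.S i, 0, .zero (LinearEquiv.refl _ _), D.hasRadicalVector_of_simple i, fun j => ?_,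
      fun j => ?_, fun h => absurd h (lt_irrefl 0)⟩
    · rw [D.homDim_S, Nat.cast_zero, chebyshevMatrix_zero, Matrix.one_apply]
      simp only [eq_comm]
      split_ifs <;> rfl
    · rw [Nat.cast_zero, zero_sub, chebyshevMatrix_neg_one]
      rfl
  | succ k ih =>
    obtain ⟨M, r, hM, hv, ht, hr, -⟩ := ih fun k' h => hk k' (h.trans k.le_succ)
    have := hv.finite
    obtain ⟨P, π, -, hπ⟩ := exists_isProjectiveCover (Λ := Λ) M
    have hsum := sum_sub_eq_chebyshevMatrix ht hr
    rcases hv.step D hπ with ⟨s, -, h⟩ | ⟨hns, hv', h⟩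
    · exfalso
      refine hk (k + 1) le_rfl (funext fun j => ?_)
      rw [Matrix.col_apply, Nat.cast_add, Nat.cast_one, ← hsum, (h j).2, sub_self]
      rfl
    · refine ⟨ModuleCat.of Λ (LinearMap.ker π), _, .succ π hπ (LinearEquiv.refl _ _) hM, hv',
        fun j => ?_, fun j => ?_, fun _ => hns⟩
      · rw [Nat.cast_add, Nat.cast_one, ← hsum, ← h j]
        push_cast
        exact (add_sub_cancel_right _ _).symm
      · rw [ht, Nat.cast_add, Nat.cast_one, add_sub_cancel_right]

include D in
theorem chebyshevMatrix_nonneg (i : ι) (k : ℕ)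
    (hk : ∀ k' < k, (chebyshevMatrix A k').col i ≠ 0) (j : ι) : 0 ≤ chebyshevMatrix A k j i := by
  by_cases h : (chebyshevMatrix A k).col i = 0
  · exact (congrFun h j).ge
  · obtain ⟨M, r, -, -, ht, -⟩ := D.exists_syzygy i k fun k' hk' => by
      rcases hk'.lt_or_eq with hlt | rfl
      exacts [hk k' hlt, h]
    rw [← ht]
    positivity

/-- The syzygy of `S i` at the first zero of the columns `S_k(A) e_i` is simple. -/
theorem exists_syzygy_simple (i : ι) (m : ℕ) (hm : FirstZeroAt A i (m + 1)) :
    ∃ s, IsSyzygy (m + 1) (D.S i) (D.S s) ∧ (chebyshevMatrix A m).col i = Pi.single s 1 := by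
  obtain ⟨M, r, hM, hv, ht, hr, -⟩ := D.exists_syzygy i m fun k hk => hm.1 k (by omega)
  have := hv.finite
  obtain ⟨P, π, hP, hπ⟩ := exists_isProjectiveCover (Λ := Λ) M
  have hsum : ∀ j, _ = (0 : ℤ) := fun j =>
    (sum_sub_eq_chebyshevMatrix ht hr j).trans (by
      have := congrFun hm.2 j
      rwa [Matrix.col_apply, Nat.cast_add, Nat.cast_one] at this)
  rcases hv.step D hπ with ⟨s, ⟨e⟩, h⟩ | ⟨-, hv', h⟩
  · refine ⟨s, .succ π hπ e.symm hM, funext fun j => ?_⟩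
    rw [Matrix.col_apply, ← ht, (h j).1, Pi.single_apply]
    split_ifs <;> rfl
  · exfalso
    have := hv'.nontrivial
    obtain ⟨j, hj⟩ := D.exists_homDim_S_ne_zero (LinearMap.ker π)
    have h1 := hsum j
    rw [← h j] at h1
    push_cast at h1
    rw [add_sub_cancel_right] at h1
    exact hj (by exact_mod_cast h1)

include D in
/-- In a connected diagram the columns `S_k(A) e_i` vanish for the first time at the same index `m`
for all `i`: if `m` is the least such index, then the columns of `S_m(A)` are nonnegative, and
`S_m(A) A e_i = A S_m(A) e_i = 0` shows that they vanish at the neighbours of `i` if they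
vanish at `i`. -/
theorem firstZeroAt_of_connected (hsymm : ∀ i j, A i j = A j i) (hconn : IsConnectedDiagram A)
    {i₀ : ι} {m : ℕ} (hm : FirstZeroAt A i₀ m) (i : ι) : FirstZeroAt A i m := by
  classical
  have hex : ∃ k : ℕ, ∃ i, (chebyshevMatrix A k).col i = 0 := ⟨m, i₀, hm.2⟩
  have hmin : ∀ k < Nat.find hex, ∀ i, (chebyshevMatrix A k).col i ≠ 0 := fun k hk i h =>
    Nat.find_min hex hk ⟨i, h⟩
  have hspec := Nat.find_spec hex
  have hall := hconn (fun i => (chebyshevMatrix A (Nat.find hex)).col i = 0) hspec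
    fun i j hi hij => by
      have h0 : ∀ l, ∑ x, chebyshevMatrix A (Nat.find hex) l x * (A x i : ℤ) = 0 := fun l => by
        have h1 := congrFun (congrFun (chebyshevMatrix_comm A (Nat.find hex) 1) l) i
        rw [chebyshevMatrix_one, Matrix.mul_apply, Matrix.mul_apply] at h1
        refine h1.trans (Finset.sum_eq_zero fun x _ => ?_)
        have h2 := congrFun hi x
        rw [Matrix.col_apply] at h2
        rw [h2, Pi.zero_apply, mul_zero]
      funext l
      have h1 := (Finset.sum_eq_zero_iff_of_nonneg fun x _ => mul_nonneg
        (D.chebyshevMatrix_nonneg x _ (fun k hk => hmin k hk x) l) (by positivity)).1 (h0 l) j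
        (Finset.mem_univ j)
      rw [hsymm] at hij
      exact (mul_eq_zero.1 h1).resolve_right (by exact_mod_cast hij)
  have heq : Nat.find hex = m := by
    refine le_antisymm (Nat.find_min' hex ⟨i₀, hm.2⟩) ?_
    by_contra hlt
    exact hm.1 _ (not_le.1 hlt) (hall i₀)
  rw [heq] at hall hmin
  exact ⟨fun k hk => hmin k hk i, hall i⟩

include D in
theorem not_isSyzygy_of_lt {i : ι} {m : ℕ} (hm : FirstZeroAt A i m) {q : ℕ} (hq : 0 < q)
    (hqm : q < m) {T : ModuleCat.{u} Λ} (hT : IsSimpleModule Λ T) : ¬ IsSyzygy q (D.S i) T := by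
  intro h
  obtain ⟨M, r, hM, -, -, -, hns⟩ := D.exists_syzygy i q fun k hk => hm.1 k (by omega)
  obtain ⟨e⟩ := hM.nonempty_equiv h (LinearEquiv.refl _ _)
  exact hns hq (IsSimpleModule.congr e)

include D in
/-- If the columns `S_k(A) e_i` vanish for the first time at `m + 1` and `S_m(A) = 1`, then the
period is `m + 1`. -/
theorem havePeriod_of_eq_one [Nonempty ι] {m : ℕ} (hm : ∀ i, FirstZeroAt A i (m + 1))
    (h1 : chebyshevMatrix A m = 1) : SimpleResolutionsHavePeriod Λ (m + 1) := by
  refine ⟨⟨m.succ_pos, (D.repeatAfter_iff m.succ_pos).2 fun i => ?_⟩, fun q ⟨hq, h⟩ => ?_⟩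
  · obtain ⟨s, hs, hcol⟩ := D.exists_syzygy_simple i m (hm i)
    have : s = i := by
      by_contra hne
      have := congrFun hcol i
      rw [h1, Matrix.col_apply, Matrix.one_apply_eq, Pi.single_eq_of_ne (Ne.symm hne)] at this
      exact one_ne_zero this
    rwa [this] at hs
  · by_contra hlt
    obtain ⟨i⟩ := ‹Nonempty ι›
    exact D.not_isSyzygy_of_lt (hm i) hq (not_le.1 hlt) (D.simple i)
      ((D.repeatAfter_iff hq).1 h i)

include D in
/-- If the columns `S_k(A) e_i` vanish for the first time at `m + 1` and `S_m(A) ≠ 1`, then the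
period is `2 (m + 1)`, because `S_m(A)` is the matrix of an involution. -/
theorem havePeriod_of_ne_one {m : ℕ} (hm : ∀ i, FirstZeroAt A i (m + 1))
    (h1 : chebyshevMatrix A m ≠ 1) : SimpleResolutionsHavePeriod Λ (2 * (m + 1)) := by
  choose σ hσ hcol using fun i => D.exists_syzygy_simple i m (hm i)
  have hzero : chebyshevMatrix A (m + 1) = 0 := by
    ext j i
    have := congrFun (hm i).2 j
    rwa [Matrix.col_apply, Nat.cast_add, Nat.cast_one] at this
  have hsq := chebyshevMatrix_sq A hzero
  have hentry : ∀ j i, chebyshevMatrix A m j i = if j = σ i then 1 else 0 := fun j i => by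
    have := congrFun (hcol i) j
    rwa [Matrix.col_apply, Pi.single_apply] at this
  have hinv : ∀ i, σ (σ i) = i := fun i => by
    have h2 := congrFun (congrFun hsq i) i
    rw [Matrix.mul_apply, Matrix.one_apply_eq] at h2
    simp only [hentry, mul_ite, mul_one, mul_zero, Finset.sum_ite_eq', Finset.mem_univ,
      if_true] at h2
    by_contra hne
    rw [if_neg (Ne.symm hne)] at h2
    exact zero_ne_one h2
  have hmove : ∃ i, σ i ≠ i := by
    by_contra! hfix
    refine h1 (Matrix.ext fun j i => ?_)
    rw [hentry, hfix, Matrix.one_apply]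
  refine ⟨⟨by omega, (D.repeatAfter_iff (by omega)).2 fun i => ?_⟩, fun q ⟨hq, h⟩ => ?_⟩
  · have h2 := hσ (σ i)
    rw [hinv] at h2
    rw [two_mul]
    exact (hσ i).add h2
  · by_contra hlt
    have hsyz := (D.repeatAfter_iff hq).1 h
    obtain ⟨i, hi⟩ := hmove
    rcases lt_trichotomy q (m + 1) with hlt' | rfl | hgt
    · exact D.not_isSyzygy_of_lt (hm i) hq hlt' (D.simple i) (hsyz i)
    · obtain ⟨e⟩ := (hσ i).nonempty_equiv (hsyz i) (LinearEquiv.refl _ _)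
      exact hi (D.eq_of_equiv e)
    · obtain ⟨M, r, hM, -, -, -, hns⟩ := D.exists_syzygy (σ i) (q - (m + 1))
        fun k hk => (hm (σ i)).1 k (by omega)
      have h2 := (hσ i).add hM
      rw [Nat.add_sub_cancel' hgt.le] at h2
      obtain ⟨e⟩ := h2.nonempty_equiv (hsyz i) (LinearEquiv.refl _ _)
      exact hns (by omega) (IsSimpleModule.congr e)

end RadCubeZeroData

/-! ### First extension groups -/

/-- `Ext¹(M, T)` is `Hom(Ω M, T)` for `T` simple. -/
theorem IsProjectiveCover.finrank_ext (K : Type v) {Λ : Type u} [Field K] [Ring Λ] [Algebra K Λ]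
    [IsArtinianRing Λ] {P M T : ModuleCat.{u} Λ} {π : P →ₗ[Λ] M} (hπ : IsProjectiveCover π)
    [IsSimpleModule Λ T] :
    Module.finrank K (Abelian.Ext M T 1) = homDim K Λ (LinearMap.ker π) T := by
  let C := π.shortComplexKer
  have hC : C.ShortExact := LinearMap.shortExact_shortComplexKer hπ.surjective
  have : Projective C.X₂ := (IsProjective.iff_projective P).1 hπ.projective
  let δ : Abelian.Ext C.X₁ T 0 →ₗ[K] Abelian.Ext C.X₃ T 1 :=
    hC.extClass.precompOfLinear K T (add_comm 1 0)
  have hδs : Function.Surjective δ := precomp_extClass_surjective_of_projective_X₂ T hC 0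
  have hδi : Function.Injective δ := by
    refine (injective_iff_map_eq_zero δ).2 fun x hx => ?_
    obtain ⟨y, rfl⟩ := Abelian.Ext.contravariant_sequence_exact₁ hC T x (add_comm 1 0) hx
    obtain ⟨g, rfl⟩ := Abelian.Ext.homEquiv₀.symm.surjective y
    have hfg : C.f ≫ g = 0 := by
      ext x
      exact jacobson_smul_le_ker socle_eq_top_of_simple g.hom
        (hπ.superfluous.le_jacobson_smul x.2)
    rw [Abelian.Ext.homEquiv₀_symm_apply, Abelian.Ext.mk₀_comp_mk₀, hfg, Abelian.Ext.mk₀_zero]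
  have e1 := (LinearEquiv.ofBijective δ ⟨hδi, hδs⟩).finrank_eq
  have e2 := (Abelian.Ext.linearEquiv₀ (R := K) (X := C.X₁) (Y := T)).finrank_eq
  let _ : Module K T := Module.restrictScalars K Λ T
  have : IsScalarTower K Λ T := IsScalarTower.restrictScalars K Λ T
  have e3 := (ModuleCat.homLinearEquiv (S := K) (M := C.X₁) (N := T)).finrank_eq
  exact e1.symm.trans (e2.trans e3)

/-! ### Algebras with a given diagram -/

theorem homDim_le_of_surjective (K : Type v) {Λ : Type u} [Field K] [Ring Λ] [Algebra K Λ]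
    [Module.Finite K Λ] {M M' N : Type u} [AddCommGroup M] [Module Λ M] [AddCommGroup M']
    [Module Λ M'] [AddCommGroup N] [Module Λ N] [Module.Finite Λ M] [Module.Finite Λ N]
    (g : M →ₗ[Λ] M') (hg : Function.Surjective g) : homDim K Λ M' N ≤ homDim K Λ M N := by
  let _ : Module K M := Module.restrictScalars K Λ M
  have : IsScalarTower K Λ M := IsScalarTower.restrictScalars K Λ M
  let _ : Module K N := Module.restrictScalars K Λ N
  have : IsScalarTower K Λ N := IsScalarTower.restrictScalars K Λ N
  have := finite_hom K (Λ := Λ) (M := M) (N := N)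
  refine LinearMap.finrank_le_finrank_of_injective (f := LinearMap.lcomp K N g) fun a b hab => ?_
  ext x
  obtain ⟨y, rfl⟩ := hg x
  exact LinearMap.congr_fun hab y

/-- For a connected diagram without multiple edges on at least two vertices, the endomorphism ring
of every simple module is `K`: it embeds in a one-dimensional space `Ext¹(S i, S j)`. -/
theorem HasDiagram.nonempty_data {K : Type v} {Λ : Type u} [Field K] [Ring Λ] [Algebra K Λ]
    [Module.Finite K Λ] [IsArtinianRing Λ] (hsymm : IsSymmetricAlg K Λ)
    (hrad : Ring.jacobson Λ ^ 3 = ⊥) {n : ℕ} [Nontrivial (Fin n)]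
    {A : Matrix (Fin n) (Fin n) ℕ} (hA : ∀ i j, A i j = A j i) (hA1 : ∀ i j, A i j ≤ 1)
    (hconn : IsConnectedDiagram A) (h : HasDiagram K Λ A) :
    Nonempty (RadCubeZeroData K Λ (Fin n) A) := by
  obtain ⟨S, hS, hdist, hcomplete, hext⟩ := h
  have hcover : ∀ i, ∃ (P : ModuleCat.{u} Λ) (π : P →ₗ[Λ] S i), IsProjectiveCover π := fun i => by
    obtain ⟨P, π, -, h⟩ := exists_isProjectiveCover (Λ := Λ) (S i)
    exact ⟨P, π, h⟩
  choose P π hπ using hcover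
  have hnb : ∀ i, ∃ j, j ≠ i ∧ A i j ≠ 0 := fun i => by
    by_contra! hne
    obtain ⟨j, hj⟩ := exists_ne i
    refine hj (hconn (fun l => l = i) ⟨i, rfl⟩ (fun a b ha hab => ?_) j)
    by_contra hb
    exact hab (ha ▸ hne b hb)
  have hfin : ∀ i, Module.Finite Λ (P i) := fun i => (hπ i).finite
  have hker : ∀ i j, homDim K Λ (LinearMap.ker (π i)) (S j) = A i j := fun i j =>
    ((hπ i).finrank_ext K).symm.trans (hext i j)
  have hkerJ : ∀ i, LinearMap.ker (π i) = Ring.jacobson Λ • ⊤ := fun i =>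
    le_antisymm (hπ i).superfluous.le_jacobson_smul
      (jacobson_smul_le_ker socle_eq_top_of_simple _)
  refine ⟨⟨hsymm, hrad, S, P, π, hS, fun T _ _ hT => ?_, fun i j => ?_, hπ, fun i j => ?_, hnb⟩⟩
  · obtain ⟨i, ⟨e⟩⟩ := hcomplete (ModuleCat.of Λ T) hT
    exact ⟨i, ⟨e.toLinearEquiv⟩⟩
  · split_ifs with hij
    · subst hij
      obtain ⟨l, -, hl⟩ := hnb i
      rw [hA, ← hker] at hl
      obtain ⟨f, hf⟩ : ∃ f : LinearMap.ker (π l) →ₗ[Λ] S i, f ≠ 0 := by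
        by_contra! hne
        exact hl ((homDim_eq_zero_iff K).2 hne)
      have h1 := homDim_le_of_surjective K (N := S i) f
        (f.surjective_or_eq_zero.resolve_right hf)
      have h2 := hA1 l i
      rw [← hker] at h2
      have h3 : homDim K Λ (S i) (S i) ≠ 0 := fun h0 => by
        have := (homDim_eq_zero_iff K).1 h0 LinearMap.id
        have hn := IsSimpleModule.nontrivial Λ (S i)
        obtain ⟨x, hx⟩ := exists_ne (0 : S i)
        exact hx (LinearMap.congr_fun this x)
      omega
    · refine (homDim_eq_zero_iff K).2 fun f => f.bijective_or_eq_zero.resolve_left fun hf => ?_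
      exact hij (hdist i j ⟨(LinearEquiv.ofBijective f hf).toModuleIso⟩)
  · rw [← hkerJ, hker]

/-- The periods of the simple modules are determined by the matrices `S_k(A)`: if the columns
`S_k(A) e_i` vanish for the first time at `m + 1` for one vertex `i`, then the period is `m + 1`
or `2 (m + 1)`, according to whether `S_m(A)` is the identity or not. -/
theorem HasDiagram.havePeriod {K : Type v} {Λ : Type u} [Field K] [Ring Λ] [Algebra K Λ]
    [Module.Finite K Λ] (hsymm : IsSymmetricAlg K Λ)
    (hrad : Ring.jacobson Λ ^ 3 = ⊥) {n : ℕ} (hn : 2 ≤ n)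
    {A : Matrix (Fin n) (Fin n) ℕ} (hA : ∀ i j, A i j = A j i) (hA1 : ∀ i j, A i j ≤ 1)
    (hconn : IsConnectedDiagram A) (h : HasDiagram K Λ A) {i : Fin n} {m : ℕ}
    (hm : FirstZeroAt A i (m + 1)) :
    (chebyshevMatrix A m = 1 → SimpleResolutionsHavePeriod Λ (m + 1)) ∧
    (chebyshevMatrix A m ≠ 1 → SimpleResolutionsHavePeriod Λ (2 * (m + 1))) := by
  have := IsArtinianRing.of_finite K Λ
  have := Fin.nontrivial_iff_two_le.2 hn
  have : Nonempty (Fin n) := ⟨i⟩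
  obtain ⟨D⟩ := h.nonempty_data hsymm hrad hA hA1 hconn
  have hm' := D.firstZeroAt_of_connected hA hconn hm
  exact ⟨D.havePeriod_of_eq_one hm', D.havePeriod_of_ne_one hm'⟩

/-- A diagram is connected if every vertex other than a root has a neighbour of smaller height. -/
theorem isConnectedDiagram_of_height {ι : Type} {A : Matrix ι ι ℕ} (hA : ∀ i j, A i j = A j i)
    (f : ι → ℕ) (r : ι)
    (h : ∀ i, i ≠ r → ∃ j, A i j ≠ 0 ∧ f j < f i) : IsConnectedDiagram A := by
  intro Z ⟨i, hi⟩ hZ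
  have key : ∀ d i, f i = d → (Z i ↔ Z r) := by
    intro d
    induction d using Nat.strong_induction_on with
    | _ d ih =>
    intro i hd
    by_cases hir : i = r
    · rw [hir]
    · obtain ⟨j, hj, hlt⟩ := h i hir
      rw [← ih _ (hd ▸ hlt) j rfl]
      exact ⟨fun h => hZ i j h hj, fun h => hZ j i h (hA i j ▸ hj)⟩
  exact fun j => (key _ j rfl).2 ((key _ i rfl).1 hi)

/-! ### Columns of Chebyshev matrices -/

section Columns

variable {ι : Type} [Fintype ι] [DecidableEq ι] {A : Matrix ι ι ℕ}

/-- The columns `S_k(A) e_i` are determined by their recurrence, which is stated without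
subtraction. -/
theorem chebyshevMatrix_apply_eq {i : ι} (v : ℕ → ι → ℕ) {N : ℕ}
    (h0 : ∀ j, v 0 j = if j = i then 1 else 0) (h1 : ∀ j, v 1 j = A j i)
    (hrec : ∀ k, k + 2 ≤ N → ∀ j, v (k + 2) j + v k j = ∑ l, A j l * v (k + 1) l) (k : ℕ)
    (hk : k ≤ N) (j : ι) : chebyshevMatrix A k j i = v k j := by
  induction k using Nat.strong_induction_on generalizing j with
  | _ k ih =>
  match k with
  | 0 => rw [Nat.cast_zero, chebyshevMatrix_zero, h0, Matrix.one_apply, Nat.cast_ite,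
      Nat.cast_one, Nat.cast_zero]
  | 1 => rw [Nat.cast_one, chebyshevMatrix_one, h1, Matrix.map_apply]
  | k + 2 =>
    have h2 := hrec k hk j
    have h3 : ((k + 2 : ℕ) : ℤ) = ((k + 1 : ℕ) : ℤ) + 1 := by push_cast; ring
    have h4 : ((k + 1 : ℕ) : ℤ) - 1 = (k : ℕ) := by push_cast; ring
    rw [h3, chebyshevMatrix_add_one, h4, Matrix.sub_apply, Matrix.mul_apply,
      ih k (by omega) (by omega) j, sub_eq_iff_eq_add, ← Nat.cast_add, h2]
    push_cast
    refine Finset.sum_congr rfl fun l _ => ?_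
    rw [← Nat.cast_one (R := ℤ), ← Nat.cast_add, ih (k + 1) (by omega) (by omega) l,
      Matrix.map_apply]

theorem firstZeroAt_of_recurrence {i : ι} (v : ℕ → ι → ℕ) {m : ℕ}
    (h0 : ∀ j, v 0 j = if j = i then 1 else 0) (h1 : ∀ j, v 1 j = A j i)
    (hrec : ∀ k, k + 2 ≤ m → ∀ j, v (k + 2) j + v k j = ∑ l, A j l * v (k + 1) l)
    (hne : ∀ k < m, ∃ j, v k j ≠ 0) (hm : ∀ j, v m j = 0) : FirstZeroAt A i m := by
  have h := chebyshevMatrix_apply_eq v h0 h1 hrec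
  refine ⟨fun k hk h' => ?_, funext fun j => ?_⟩
  · obtain ⟨j, hj⟩ := hne k hk
    have := congrFun h' j
    rw [Matrix.col_apply, h k hk.le, Pi.zero_apply] at this
    exact hj (by exact_mod_cast this)
  · rw [Matrix.col_apply, h m le_rfl, hm]
    rfl

/-- The matrices `S_k(A)` commute, so that a vector fixed by `S_m(A)` remains so when `S_k(A)` is
applied to it. -/
theorem chebyshevMatrix_fix {m k : ℤ} {v : ι → ℤ} (h : (chebyshevMatrix A m).mulVec v = v) :
    (chebyshevMatrix A m).mulVec ((chebyshevMatrix A k).mulVec v) =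
      (chebyshevMatrix A k).mulVec v := by
  rw [Matrix.mulVec_mulVec, chebyshevMatrix_comm, ← Matrix.mulVec_mulVec, h]

theorem chebyshevMatrix_eq_one {m : ℤ}
    (h : ∀ i, (chebyshevMatrix A m).mulVec (Pi.single i 1) = Pi.single i 1) :
    chebyshevMatrix A m = 1 := by
  ext i j
  have := congrFun (h j) i
  rw [Matrix.mulVec_single_one, Matrix.col_apply] at this
  rw [this, Matrix.one_apply, Pi.single_apply]

end Columns

section Columns

variable {ι : Type} [Fintype ι] [DecidableEq ι] {A : Matrix ι ι ℕ}

/-- If the sequence of columns `v k = S_k(A) e_i` returns to `v 0 = e_i` at `m`, then `S_m(A)` fixes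
all of them. -/
theorem chebyshevMatrix_fix_column {i : ι} {v : ℕ → ι → ℕ} {N m : ℕ}
    (h : ∀ k ≤ N, ∀ j, chebyshevMatrix A k j i = v k j)
    (hm : (chebyshevMatrix A m).col i = Pi.single i 1) (k : ℕ) (hk : k ≤ N) :
    (chebyshevMatrix A m).mulVec (fun j => (v k j : ℤ)) = fun j => (v k j : ℤ) := by
  have h1 : (chebyshevMatrix A k).mulVec (Pi.single i 1) = fun j => (v k j : ℤ) := by
    rw [Matrix.mulVec_single_one]
    exact funext fun j => h k hk j
  rw [← h1]
  exact chebyshevMatrix_fix (by rw [Matrix.mulVec_single_one, hm])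

end Columns

/-! ### The diagrams -/

theorem adjacencyOf_apply (n : ℕ) (r : ℕ → ℕ → Prop) (i j : Fin n) [Decidable (r i j ∨ r j i)] :
    adjacencyOf n r i j = if r i j ∨ r j i then 1 else 0 := by
  simp only [adjacencyOf, Matrix.of_apply]
  congr

theorem adjacencyOf_comm (n : ℕ) (r : ℕ → ℕ → Prop) (i j : Fin n) :
    adjacencyOf n r i j = adjacencyOf n r j i := by
  classical
  rw [adjacencyOf_apply, adjacencyOf_apply]
  simp only [or_comm]

theorem adjacencyOf_le_one (n : ℕ) (r : ℕ → ℕ → Prop) (i j : Fin n) :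
    adjacencyOf n r i j ≤ 1 := by
  classical
  rw [adjacencyOf_apply]
  split_ifs <;> omega

theorem adjacencyOf_ne_zero {n : ℕ} {r : ℕ → ℕ → Prop} {i j : Fin n} (h : r i j ∨ r j i) :
    adjacencyOf n r i j ≠ 0 := by
  classical
  rw [adjacencyOf_apply, if_pos h]
  exact one_ne_zero

theorem diagramA_apply {n : ℕ} (i j : Fin n) :
    diagramA n i j = if (j : ℕ) = i + 1 ∨ (i : ℕ) = j + 1 then 1 else 0 :=
  adjacencyOf_apply _ _ _ _

theorem diagramL_apply {n : ℕ} (i j : Fin n) :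
    diagramL n i j = if ((j : ℕ) = i + 1 ∨ ((i : ℕ) = 0 ∧ (j : ℕ) = 0)) ∨
      ((i : ℕ) = j + 1 ∨ ((j : ℕ) = 0 ∧ (i : ℕ) = 0)) then 1 else 0 :=
  adjacencyOf_apply _ _ _ _

theorem diagramD_apply {n : ℕ} (i j : Fin n) :
    diagramD n i j =
      if (((i : ℕ) = 0 ∧ (j : ℕ) = 2) ∨ ((i : ℕ) = 1 ∧ (j : ℕ) = 2) ∨
          (2 ≤ (i : ℕ) ∧ (j : ℕ) = i + 1)) ∨
        (((j : ℕ) = 0 ∧ (i : ℕ) = 2) ∨ ((j : ℕ) = 1 ∧ (i : ℕ) = 2) ∨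
          (2 ≤ (j : ℕ) ∧ (i : ℕ) = j + 1))
      then 1 else 0 :=
  adjacencyOf_apply _ _ _ _

theorem diagramE_apply {n : ℕ} (i j : Fin n) :
    diagramE n i j = if (((j : ℕ) = i + 1 ∧ (j : ℕ) + 1 < n) ∨ ((i : ℕ) = 2 ∧ (j : ℕ) + 1 = n)) ∨
      (((i : ℕ) = j + 1 ∧ (i : ℕ) + 1 < n) ∨ ((j : ℕ) = 2 ∧ (i : ℕ) + 1 = n)) then 1 else 0 :=
  adjacencyOf_apply _ _ _ _

theorem isConnectedDiagram_A {n : ℕ} (hn : 2 ≤ n) : IsConnectedDiagram (diagramA n) := by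
  refine isConnectedDiagram_of_height (adjacencyOf_comm _ _) (fun i => i) ⟨0, by omega⟩ ?_
  intro i hi
  have hi' : (i : ℕ) ≠ 0 := fun h => hi (Fin.ext h)
  exact ⟨⟨i - 1, by omega⟩, adjacencyOf_ne_zero (Or.inr (by dsimp only; omega)),
    by dsimp only; omega⟩

theorem isConnectedDiagram_L {n : ℕ} (hn : 2 ≤ n) : IsConnectedDiagram (diagramL n) := by
  refine isConnectedDiagram_of_height (adjacencyOf_comm _ _) (fun i => i) ⟨0, by omega⟩ ?_
  intro i hi
  have hi' : (i : ℕ) ≠ 0 := fun h => hi (Fin.ext h)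
  exact ⟨⟨i - 1, by omega⟩, adjacencyOf_ne_zero (Or.inr (Or.inl (by dsimp only; omega))),
    by dsimp only; omega⟩

theorem isConnectedDiagram_D {n : ℕ} (hn : 4 ≤ n) : IsConnectedDiagram (diagramD n) := by
  refine isConnectedDiagram_of_height (adjacencyOf_comm _ _)
    (fun i => if (i : ℕ) < 2 then n else i) ⟨2, by omega⟩ ?_
  intro i hi
  have hi' : (i : ℕ) ≠ 2 := fun h => hi (Fin.ext h)
  refine ⟨⟨if (i : ℕ) < 2 then 2 else i - 1, by split_ifs <;> omega⟩,
    adjacencyOf_ne_zero ?_, ?_⟩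
  · dsimp only
    split_ifs <;> omega
  · dsimp only
    split_ifs <;> omega

theorem isConnectedDiagram_E {n : ℕ} (hn : 4 ≤ n) : IsConnectedDiagram (diagramE n) := by
  refine isConnectedDiagram_of_height (adjacencyOf_comm _ _) (fun i => i) ⟨0, by omega⟩ ?_
  intro i hi
  have hi' : (i : ℕ) ≠ 0 := fun h => hi (Fin.ext h)
  refine ⟨⟨if (i : ℕ) + 1 = n then 2 else i - 1, by split_ifs <;> omega⟩,
    adjacencyOf_ne_zero ?_, ?_⟩
  · dsimp only
    split_ifs <;> omega
  · dsimp only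
    split_ifs <;> omega

/-! ### Type `A` -/

/-- The column `S_k(A_n) e_0` is the basis vector at `k`, and zero for `k = n`. -/
def columnA (n : ℕ) (k : ℕ) (j : Fin n) : ℕ := if (j : ℕ) = k then 1 else 0

theorem sum_mul_indicator {n : ℕ} (f : Fin n → ℕ) (a : ℕ) (ha : a < n) :
    ∑ l : Fin n, f l * (if (l : ℕ) = a then 1 else 0) = f ⟨a, ha⟩ := by
  rw [Finset.sum_eq_single ⟨a, ha⟩]
  · rw [if_pos rfl, mul_one]
  · intro b _ hb
    rw [if_neg fun h => hb (Fin.ext h), mul_zero]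
  · intro h
    exact absurd (Finset.mem_univ _) h

theorem columnA_zero {n : ℕ} (hn : 2 ≤ n) (j : Fin n) :
    columnA n 0 j = if j = ⟨0, by omega⟩ then 1 else 0 := by
  simp only [columnA, Fin.ext_iff]

theorem columnA_one {n : ℕ} (hn : 2 ≤ n) (j : Fin n) :
    columnA n 1 j = diagramA n j ⟨0, by omega⟩ := by
  rw [diagramA_apply, columnA]
  split_ifs <;> simp_all

theorem columnA_rec {n : ℕ} (k : ℕ) (hk : k + 2 ≤ n) (j : Fin n) :
    columnA n (k + 2) j + columnA n k j = ∑ l, diagramA n j l * columnA n (k + 1) l := by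
  simp only [columnA]
  rw [sum_mul_indicator _ (k + 1) (by omega), diagramA_apply]
  dsimp only
  split_ifs <;> omega

theorem firstZeroAt_A {n : ℕ} (hn : 2 ≤ n) : FirstZeroAt (diagramA n) ⟨0, by omega⟩ n := by
  refine firstZeroAt_of_recurrence (columnA n) (columnA_zero hn) (columnA_one hn) columnA_rec
    (fun k hk => ⟨⟨k, hk⟩, by simp [columnA]⟩) fun j => ?_
  rw [columnA, if_neg j.2.ne]

theorem chebyshevMatrix_A_ne_one {n : ℕ} (hn : 2 ≤ n) :
    chebyshevMatrix (diagramA n) (n - 1 : ℕ) ≠ 1 := by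
  intro h
  have h1 := chebyshevMatrix_apply_eq (columnA n) (columnA_zero hn) (columnA_one hn) columnA_rec
    (n - 1) (by omega) ⟨0, by omega⟩
  rw [h, Matrix.one_apply_eq, columnA, if_neg (by dsimp only; omega)] at h1
  exact one_ne_zero h1

/-! ### Type `L` -/

/-- The column `S_k(L_n) e_(n - 1)` is a basis vector for `k < 2 n`: it runs from `n - 1` down to
the loop vertex `0`, where it stays once, and back to `n - 1`. -/
def columnL (n : ℕ) (k : ℕ) (j : Fin n) : ℕ :=
  if k < n then (if (j : ℕ) = n - 1 - k then 1 else 0) else (if (j : ℕ) = k - n then 1 else 0)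

theorem columnL_zero {n : ℕ} (hn : 2 ≤ n) (j : Fin n) :
    columnL n 0 j = if j = ⟨n - 1, by omega⟩ then 1 else 0 := by
  simp only [columnL, Fin.ext_iff]
  split_ifs <;> omega

theorem columnL_one {n : ℕ} (hn : 2 ≤ n) (j : Fin n) :
    columnL n 1 j = diagramL n j ⟨n - 1, by omega⟩ := by
  rw [diagramL_apply, columnL]
  dsimp only
  split_ifs <;> omega

theorem columnL_rec {n : ℕ} (k : ℕ) (hk : k + 2 ≤ 2 * n) (j : Fin n) :
    columnL n (k + 2) j + columnL n k j = ∑ l, diagramL n j l * columnL n (k + 1) l := by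
  have hj := j.2
  by_cases h : k + 1 < n
  · simp only [columnL, if_pos h]
    rw [sum_mul_indicator _ (n - 1 - (k + 1)) (by omega), diagramL_apply]
    dsimp only
    split_ifs <;> omega
  · simp only [columnL, if_neg h]
    rw [sum_mul_indicator _ (k + 1 - n) (by omega), diagramL_apply]
    dsimp only
    split_ifs <;> omega

theorem columnL_apply_eq {n : ℕ} (hn : 2 ≤ n) : ∀ k ≤ 2 * n, ∀ j,
    chebyshevMatrix (diagramL n) k j ⟨n - 1, by omega⟩ = columnL n k j :=
  chebyshevMatrix_apply_eq (columnL n) (columnL_zero hn) (columnL_one hn) columnL_rec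

theorem firstZeroAt_L {n : ℕ} (hn : 2 ≤ n) :
    FirstZeroAt (diagramL n) ⟨n - 1, by omega⟩ (2 * n) := by
  refine firstZeroAt_of_recurrence (columnL n) (columnL_zero hn) (columnL_one hn) columnL_rec
    (fun k hk => ?_) fun j => ?_
  · by_cases h : k < n
    · exact ⟨⟨n - 1 - k, by omega⟩, by simp [columnL, h]⟩
    · exact ⟨⟨k - n, by omega⟩, by simp [columnL, h]⟩
  · have := j.2
    simp only [columnL]
    split_ifs <;> omega

theorem chebyshevMatrix_L_eq_one {n : ℕ} (hn : 2 ≤ n) :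
    chebyshevMatrix (diagramL n) (2 * n - 1 : ℕ) = 1 := by
  have h := columnL_apply_eq hn
  have hm : (chebyshevMatrix (diagramL n) (2 * n - 1 : ℕ)).col ⟨n - 1, by omega⟩ =
      Pi.single ⟨n - 1, by omega⟩ 1 := funext fun j => by
    rw [Matrix.col_apply, h _ (by omega), Pi.single_apply, columnL]
    simp only [Fin.ext_iff]
    split_ifs <;> omega
  refine chebyshevMatrix_eq_one fun i => ?_
  have hi := i.2
  have hv : (Pi.single i 1 : Fin n → ℤ) = fun j => (columnL n (n - 1 - i) j : ℤ) :=
    funext fun j => by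
      simp only [Pi.single_apply, columnL, Fin.ext_iff]
      split_ifs <;> omega
  rw [hv]
  exact chebyshevMatrix_fix_column h hm _ (by omega)

/-! ### Type `D` -/

/-- The column `S_k(D_n) e_(n - 1)` runs as a basis vector from `n - 1` down to the branch vertex
`2`, is `e_0 + e_1` for `k = n - 2`, and returns to `n - 1` for `k = 2 n - 4`. -/
def columnD (n : ℕ) (k : ℕ) (j : Fin n) : ℕ :=
  if k + 2 < n then (if (j : ℕ) = n - 1 - k then 1 else 0)
  else if k + 2 = n then (if (j : ℕ) = 0 then 1 else 0) + (if (j : ℕ) = 1 then 1 else 0)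
  else (if (j : ℕ) = k + 3 - n then 1 else 0)

theorem columnD_zero {n : ℕ} (hn : 4 ≤ n) (j : Fin n) :
    columnD n 0 j = if j = ⟨n - 1, by omega⟩ then 1 else 0 := by
  simp only [columnD, Fin.ext_iff]
  split_ifs <;> omega

theorem columnD_one {n : ℕ} (hn : 4 ≤ n) (j : Fin n) :
    columnD n 1 j = diagramD n j ⟨n - 1, by omega⟩ := by
  have hj := j.2
  rw [diagramD_apply, columnD]
  dsimp only
  split_ifs <;> omega

theorem diagramD_apply_of_lt_two {n : ℕ} {i : Fin n} (hi : (i : ℕ) < 2) (j : Fin n) :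
    diagramD n j i = if (j : ℕ) = 2 then 1 else 0 := by
  rw [diagramD_apply]
  split_ifs <;> omega

theorem columnD_rec {n : ℕ} (hn : 4 ≤ n) (k : ℕ) (hk : k + 2 ≤ 2 * n - 3) (j : Fin n) :
    columnD n (k + 2) j + columnD n k j = ∑ l, diagramD n j l * columnD n (k + 1) l := by
  have hj := j.2
  rcases lt_trichotomy (k + 1 + 2) n with h | h | h
  · have hsum : ∑ l, diagramD n j l * columnD n (k + 1) l =
        diagramD n j ⟨n - 1 - (k + 1), by omega⟩ := by
      rw [← sum_mul_indicator (diagramD n j)]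
      exact Finset.sum_congr rfl fun l _ => by rw [columnD, if_pos h]
    rw [hsum, diagramD_apply, columnD, columnD]
    clear hsum
    dsimp only
    split_ifs <;> omega
  · have hsum : ∑ l, diagramD n j l * columnD n (k + 1) l =
        diagramD n j ⟨0, by omega⟩ + diagramD n j ⟨1, by omega⟩ := by
      rw [← sum_mul_indicator (diagramD n j), ← sum_mul_indicator (diagramD n j),
        ← Finset.sum_add_distrib]
      exact Finset.sum_congr rfl fun l _ => by
        rw [columnD, if_neg h.not_lt, if_pos h, mul_add]
    rw [hsum, diagramD_apply_of_lt_two Nat.zero_lt_two, diagramD_apply_of_lt_two Nat.one_lt_two,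
      columnD, columnD]
    clear hsum
    split_ifs <;> omega
  · have hsum : ∑ l, diagramD n j l * columnD n (k + 1) l =
        diagramD n j ⟨k + 1 + 3 - n, by omega⟩ := by
      rw [← sum_mul_indicator (diagramD n j)]
      exact Finset.sum_congr rfl fun l _ => by rw [columnD, if_neg h.not_gt, if_neg h.ne']
    rw [hsum, diagramD_apply, columnD, columnD]
    clear hsum
    dsimp only
    split_ifs <;> omega

theorem columnD_apply_eq {n : ℕ} (hn : 4 ≤ n) : ∀ k ≤ 2 * n - 3, ∀ j,
    chebyshevMatrix (diagramD n) k j ⟨n - 1, by omega⟩ = columnD n k j :=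
  chebyshevMatrix_apply_eq (columnD n) (columnD_zero hn) (columnD_one hn) (columnD_rec hn)

theorem firstZeroAt_D {n : ℕ} (hn : 4 ≤ n) :
    FirstZeroAt (diagramD n) ⟨n - 1, by omega⟩ (2 * n - 3) := by
  refine firstZeroAt_of_recurrence (columnD n) (columnD_zero hn) (columnD_one hn) (columnD_rec hn)
    (fun k hk => ?_) fun j => ?_
  · rcases lt_trichotomy (k + 2) n with h | h | h
    · exact ⟨⟨n - 1 - k, by omega⟩, by simp [columnD, h]⟩
    · exact ⟨⟨0, by omega⟩, by simp [columnD, h]⟩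
    · exact ⟨⟨k + 3 - n, by omega⟩, by simp [columnD, not_lt_of_gt h, h.ne']⟩
  · have := j.2
    simp only [columnD]
    split_ifs <;> omega

/-- The difference `e_0 - e_1` of the two short ends of `D_n`. -/
def forkVector (n : ℕ) (j : Fin n) : ℤ :=
  (if (j : ℕ) = 0 then 1 else 0) - (if (j : ℕ) = 1 then 1 else 0)

theorem diagramD_mulVec_forkVector {n : ℕ} (hn : 4 ≤ n) :
    ((diagramD n).map (Nat.cast : ℕ → ℤ)).mulVec (forkVector n) = 0 := by
  funext j
  have h0 : diagramD n j ⟨0, by omega⟩ = diagramD n j ⟨1, by omega⟩ := by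
    rw [diagramD_apply_of_lt_two Nat.zero_lt_two, diagramD_apply_of_lt_two Nat.one_lt_two]
  have h1 := sum_mul_indicator (diagramD n j) 0 (show 0 < n by omega)
  have h2 := sum_mul_indicator (diagramD n j) 1 (show 1 < n by omega)
  rw [← h0, ← h1] at h2
  simp only [Matrix.mulVec, dotProduct, forkVector, mul_sub, Finset.sum_sub_distrib,
    Matrix.map_apply, Pi.zero_apply]
  exact sub_eq_zero.2 (by exact_mod_cast h2.symm)

/-- Since `e_0 - e_1` is an eigenvector of `D_n` with eigenvalue `0`, it is an eigenvector of
`S_(2 k)(D_n)` with eigenvalue `S_(2 k)(0) = (-1)^k`. -/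
theorem chebyshevMatrix_mulVec_forkVector {n : ℕ} (hn : 4 ≤ n) (k : ℕ) :
    (chebyshevMatrix (diagramD n) (2 * k : ℕ)).mulVec (forkVector n) =
      (-1 : ℤ) ^ k • forkVector n := by
  induction k with
  | zero => simp [chebyshevMatrix_zero]
  | succ k ih =>
    have h1 : ((2 * (k + 1) : ℕ) : ℤ) = ((2 * k : ℕ) + 1 : ℤ) + 1 := by push_cast; ring
    have h2 : ((2 * k : ℕ) + 1 : ℤ) - 1 = (2 * k : ℕ) := by push_cast; ring
    have hcomm := chebyshevMatrix_comm (diagramD n) 1 ((2 * k : ℕ) + 1)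
    rw [chebyshevMatrix_one] at hcomm
    rw [h1, chebyshevMatrix_add_one, h2, hcomm, Matrix.sub_mulVec, ← Matrix.mulVec_mulVec,
      diagramD_mulVec_forkVector hn, Matrix.mulVec_zero, ih, zero_sub, pow_succ, mul_neg_one,
      neg_smul]

theorem chebyshevMatrix_D_eq_one {n : ℕ} (hn : 4 ≤ n) (he : Even n) :
    chebyshevMatrix (diagramD n) (2 * n - 4 : ℕ) = 1 := by
  have h := columnD_apply_eq hn
  have hm : (chebyshevMatrix (diagramD n) (2 * n - 4 : ℕ)).col ⟨n - 1, by omega⟩ =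
      Pi.single ⟨n - 1, by omega⟩ 1 := funext fun j => by
    rw [Matrix.col_apply, h _ (by omega), Pi.single_apply, columnD]
    simp only [Fin.ext_iff]
    split_ifs <;> omega
  have hfork : (chebyshevMatrix (diagramD n) (2 * n - 4 : ℕ)).mulVec (forkVector n) =
      forkVector n := by
    have h2 : 2 * n - 4 = 2 * (n - 2) := by omega
    have h3 : Even (n - 2) := (Nat.even_sub (by omega)).2 (by simp [he])
    rw [h2, chebyshevMatrix_mulVec_forkVector hn, h3.neg_one_pow, one_smul]
  have hsum := chebyshevMatrix_fix_column h hm (n - 2) (by omega)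
  -- twice a basis vector at an end of the fork is the sum or difference of fixed vectors
  have hhalf : ∀ v w : Fin n → ℤ, (chebyshevMatrix (diagramD n) (2 * n - 4 : ℕ)).mulVec w = w →
      w = (2 : ℤ) • v → (chebyshevMatrix (diagramD n) (2 * n - 4 : ℕ)).mulVec v = v := by
    rintro v w hw rfl
    rw [Matrix.mulVec_smul] at hw
    exact smul_right_injective _ two_ne_zero hw
  refine chebyshevMatrix_eq_one fun i => ?_
  have hi := i.2
  by_cases hi0 : (i : ℕ) = 0
  · refine hhalf _ _ ((Matrix.mulVec_add _ _ _).trans (congrArg₂ (· + ·) hsum hfork))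
      (funext fun j => ?_)
    simp only [Pi.add_apply, Pi.smul_apply, Pi.single_apply, columnD, forkVector, Fin.ext_iff,
      smul_eq_mul]
    split_ifs <;> omega
  by_cases hi1 : (i : ℕ) = 1
  · refine hhalf _ _ ((Matrix.mulVec_sub _ _ _).trans (congrArg₂ (· - ·) hsum hfork))
      (funext fun j => ?_)
    simp only [Pi.sub_apply, Pi.smul_apply, Pi.single_apply, columnD, forkVector, Fin.ext_iff,
      smul_eq_mul]
    split_ifs <;> omega
  · have hv : (Pi.single i 1 : Fin n → ℤ) = fun j => (columnD n (n - 1 - i) j : ℤ) :=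
      funext fun j => by
        simp only [Pi.single_apply, columnD, Fin.ext_iff]
        split_ifs <;> omega
    rw [hv]
    exact chebyshevMatrix_fix_column h hm _ (by omega)

theorem chebyshevMatrix_D_ne_one {n : ℕ} (hn : 4 ≤ n) (ho : Odd n) :
    chebyshevMatrix (diagramD n) (2 * n - 4 : ℕ) ≠ 1 := by
  intro h1
  have h2 : 2 * n - 4 = 2 * (n - 2) := by omega
  have h3 : Odd (n - 2) := Nat.Odd.sub_even (by omega) ho even_two
  have h4 := chebyshevMatrix_mulVec_forkVector hn (n - 2)
  rw [← h2, h1, Matrix.one_mulVec, h3.neg_one_pow, neg_one_smul] at h4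
  have h5 := congrFun h4 ⟨0, by omega⟩
  simp [forkVector] at h5

/-! ### Type `E` -/

/-- The columns `S_k(E_6) e_4`; the last nonzero one, for `k = 10`, is `e_0`. -/
def columnE6 (k : ℕ) (j : Fin 6) : ℕ :=
  ([[0, 0, 0, 0, 1, 0], [0, 0, 0, 1, 0, 0], [0, 0, 1, 0, 0, 0], [0, 1, 0, 0, 0, 1],
    [1, 0, 1, 0, 0, 0], [0, 1, 0, 1, 0, 0], [0, 0, 1, 0, 1, 0], [0, 0, 0, 1, 0, 1],
    [0, 0, 1, 0, 0, 0], [0, 1, 0, 0, 0, 0], [1, 0, 0, 0, 0, 0], [0, 0, 0, 0, 0, 0]] :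
    List (List ℕ)).getD k [] |>.getD j 0

theorem columnE6_zero (j : Fin 6) : columnE6 0 j = if j = 4 then 1 else 0 := by
  revert j
  decide

theorem columnE6_one (j : Fin 6) : columnE6 1 j = diagramE 6 j 4 := by
  rw [diagramE_apply]
  revert j
  decide

theorem columnE6_rec (k : ℕ) (hk : k + 2 ≤ 11) (j : Fin 6) :
    columnE6 (k + 2) j + columnE6 k j = ∑ l, diagramE 6 j l * columnE6 (k + 1) l := by
  simp only [diagramE_apply]
  have hk' : k < 10 := by omega
  clear hk
  revert j
  revert hk'
  revert k
  decide +kernel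

theorem columnE6_apply_eq : ∀ k : ℕ, k ≤ 11 → ∀ j,
    chebyshevMatrix (diagramE 6) k j 4 = columnE6 k j :=
  chebyshevMatrix_apply_eq columnE6 columnE6_zero columnE6_one columnE6_rec

theorem firstZeroAt_E6 : FirstZeroAt (diagramE 6) 4 11 :=
  firstZeroAt_of_recurrence columnE6 columnE6_zero columnE6_one columnE6_rec
    (by decide +kernel) (by decide)

theorem chebyshevMatrix_E6_ne_one : chebyshevMatrix (diagramE 6) (10 : ℕ) ≠ 1 := by
  intro h
  have h1 := columnE6_apply_eq 10 (by omega) 4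
  rw [h, Matrix.one_apply_eq] at h1
  exact absurd h1 (by decide)

/-- The columns `S_k(E_7) e_5`; the last nonzero one, for `k = 16`, is `e_5` again. -/
def columnE7 (k : ℕ) (j : Fin 7) : ℕ :=
  ([[0, 0, 0, 0, 0, 1, 0], [0, 0, 0, 0, 1, 0, 0], [0, 0, 0, 1, 0, 0, 0], [0, 0, 1, 0, 0, 0, 0],
    [0, 1, 0, 0, 0, 0, 1], [1, 0, 1, 0, 0, 0, 0], [0, 1, 0, 1, 0, 0, 0], [0, 0, 1, 0, 1, 0, 0],
    [0, 0, 0, 1, 0, 1, 1], [0, 0, 1, 0, 1, 0, 0], [0, 1, 0, 1, 0, 0, 0], [1, 0, 1, 0, 0, 0, 0],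
    [0, 1, 0, 0, 0, 0, 1], [0, 0, 1, 0, 0, 0, 0], [0, 0, 0, 1, 0, 0, 0], [0, 0, 0, 0, 1, 0, 0],
    [0, 0, 0, 0, 0, 1, 0], [0, 0, 0, 0, 0, 0, 0]] :
    List (List ℕ)).getD k [] |>.getD j 0

theorem columnE7_zero (j : Fin 7) : columnE7 0 j = if j = 5 then 1 else 0 := by
  revert j
  decide

theorem columnE7_one (j : Fin 7) : columnE7 1 j = diagramE 7 j 5 := by
  rw [diagramE_apply]
  revert j
  decide

theorem columnE7_rec (k : ℕ) (hk : k + 2 ≤ 17) (j : Fin 7) :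
    columnE7 (k + 2) j + columnE7 k j = ∑ l, diagramE 7 j l * columnE7 (k + 1) l := by
  simp only [diagramE_apply]
  have hk' : k < 16 := by omega
  clear hk
  revert j
  revert hk'
  revert k
  decide +kernel

theorem columnE7_apply_eq : ∀ k : ℕ, k ≤ 17 → ∀ j,
    chebyshevMatrix (diagramE 7) k j 5 = columnE7 k j :=
  chebyshevMatrix_apply_eq columnE7 columnE7_zero columnE7_one columnE7_rec

theorem firstZeroAt_E7 : FirstZeroAt (diagramE 7) 5 17 :=
  firstZeroAt_of_recurrence columnE7 columnE7_zero columnE7_one columnE7_rec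
    (by decide +kernel) (by decide)

/-- Every basis vector is an integral combination of columns `S_k(E_7) e_5`, which
`S_16(E_7)` fixes. -/
theorem chebyshevMatrix_E7_eq_one : chebyshevMatrix (diagramE 7) (16 : ℕ) = 1 := by
  have h := columnE7_apply_eq
  set S := chebyshevMatrix (diagramE 7) (16 : ℕ) with hS
  have hm : S.col 5 = Pi.single 5 1 := funext fun j => by
    rw [Matrix.col_apply, hS, h _ (by omega)]
    revert j
    decide
  let v (k : ℕ) (j : Fin 7) : ℤ := columnE7 k j
  have hv (k : ℕ) (hk : k ≤ 17) : S.mulVec (v k) = v k := chebyshevMatrix_fix_column h hm k hk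
  have hsub {a b : Fin 7 → ℤ} (ha : S.mulVec a = a) (hb : S.mulVec b = b) :
      S.mulVec (a - b) = a - b := by rw [Matrix.mulVec_sub, ha, hb]
  have hadd {a b : Fin 7 → ℤ} (ha : S.mulVec a = a) (hb : S.mulVec b = b) :
      S.mulVec (a + b) = a + b := by rw [Matrix.mulVec_add, ha, hb]
  have e0 : (Pi.single 0 1 : Fin 7 → ℤ) = v 5 - v 3 := by decide
  have e1 : (Pi.single 1 1 : Fin 7 → ℤ) = v 6 - v 2 := by decide
  have e2 : (Pi.single 2 1 : Fin 7 → ℤ) = v 3 := by decide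
  have e3 : (Pi.single 3 1 : Fin 7 → ℤ) = v 2 := by decide
  have e4 : (Pi.single 4 1 : Fin 7 → ℤ) = v 1 := by decide
  have e5 : (Pi.single 5 1 : Fin 7 → ℤ) = v 0 := by decide
  have e6 : (Pi.single 6 1 : Fin 7 → ℤ) = v 4 - v 6 + v 2 := by decide
  refine chebyshevMatrix_eq_one fun i => ?_
  fin_cases i
  · exact e0 ▸ hsub (hv 5 (by omega)) (hv 3 (by omega))
  · exact e1 ▸ hsub (hv 6 (by omega)) (hv 2 (by omega))
  · exact e2 ▸ hv 3 (by omega)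
  · exact e3 ▸ hv 2 (by omega)
  · exact e4 ▸ hv 1 (by omega)
  · exact e5 ▸ hv 0 (by omega)
  · exact e6 ▸ hadd (hsub (hv 4 (by omega)) (hv 6 (by omega))) (hv 2 (by omega))

/-- The columns `S_k(E_8) e_6`; the last nonzero one, for `k = 28`, is `e_6` again. -/
def columnE8 (k : ℕ) (j : Fin 8) : ℕ :=
  ([[0, 0, 0, 0, 0, 0, 1, 0], [0, 0, 0, 0, 0, 1, 0, 0], [0, 0, 0, 0, 1, 0, 0, 0],
    [0, 0, 0, 1, 0, 0, 0, 0], [0, 0, 1, 0, 0, 0, 0, 0], [0, 1, 0, 0, 0, 0, 0, 1],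
    [1, 0, 1, 0, 0, 0, 0, 0], [0, 1, 0, 1, 0, 0, 0, 0], [0, 0, 1, 0, 1, 0, 0, 0],
    [0, 0, 0, 1, 0, 1, 0, 1], [0, 0, 1, 0, 1, 0, 1, 0], [0, 1, 0, 1, 0, 1, 0, 0],
    [1, 0, 1, 0, 1, 0, 0, 0], [0, 1, 0, 1, 0, 0, 0, 1], [0, 0, 2, 0, 0, 0, 0, 0],
    [0, 1, 0, 1, 0, 0, 0, 1], [1, 0, 1, 0, 1, 0, 0, 0], [0, 1, 0, 1, 0, 1, 0, 0],
    [0, 0, 1, 0, 1, 0, 1, 0], [0, 0, 0, 1, 0, 1, 0, 1], [0, 0, 1, 0, 1, 0, 0, 0],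
    [0, 1, 0, 1, 0, 0, 0, 0], [1, 0, 1, 0, 0, 0, 0, 0], [0, 1, 0, 0, 0, 0, 0, 1],
    [0, 0, 1, 0, 0, 0, 0, 0], [0, 0, 0, 1, 0, 0, 0, 0], [0, 0, 0, 0, 1, 0, 0, 0],
    [0, 0, 0, 0, 0, 1, 0, 0], [0, 0, 0, 0, 0, 0, 1, 0], [0, 0, 0, 0, 0, 0, 0, 0]] :
    List (List ℕ)).getD k [] |>.getD j 0

theorem columnE8_zero (j : Fin 8) : columnE8 0 j = if j = 6 then 1 else 0 := by
  revert j
  decide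

theorem columnE8_one (j : Fin 8) : columnE8 1 j = diagramE 8 j 6 := by
  rw [diagramE_apply]
  revert j
  decide

theorem columnE8_rec (k : ℕ) (hk : k + 2 ≤ 29) (j : Fin 8) :
    columnE8 (k + 2) j + columnE8 k j = ∑ l, diagramE 8 j l * columnE8 (k + 1) l := by
  simp only [diagramE_apply]
  have hk' : k < 28 := by omega
  clear hk
  revert j
  revert hk'
  revert k
  decide +kernel

theorem columnE8_apply_eq : ∀ k : ℕ, k ≤ 29 → ∀ j,
    chebyshevMatrix (diagramE 8) k j 6 = columnE8 k j :=
  chebyshevMatrix_apply_eq columnE8 columnE8_zero columnE8_one columnE8_rec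

theorem firstZeroAt_E8 : FirstZeroAt (diagramE 8) 6 29 :=
  firstZeroAt_of_recurrence columnE8 columnE8_zero columnE8_one columnE8_rec
    (by decide +kernel) (by decide)

/-- Every basis vector is an integral combination of columns `S_k(E_8) e_6`, which
`S_28(E_8)` fixes. -/
theorem chebyshevMatrix_E8_eq_one : chebyshevMatrix (diagramE 8) (28 : ℕ) = 1 := by
  have h := columnE8_apply_eq
  set S := chebyshevMatrix (diagramE 8) (28 : ℕ) with hS
  have hm : S.col 6 = Pi.single 6 1 := funext fun j => by
    rw [Matrix.col_apply, hS, h _ (by omega)]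
    revert j
    decide
  let v (k : ℕ) (j : Fin 8) : ℤ := columnE8 k j
  have hv (k : ℕ) (hk : k ≤ 29) : S.mulVec (v k) = v k := chebyshevMatrix_fix_column h hm k hk
  have hsub {a b : Fin 8 → ℤ} (ha : S.mulVec a = a) (hb : S.mulVec b = b) :
      S.mulVec (a - b) = a - b := by rw [Matrix.mulVec_sub, ha, hb]
  have hadd {a b : Fin 8 → ℤ} (ha : S.mulVec a = a) (hb : S.mulVec b = b) :
      S.mulVec (a + b) = a + b := by rw [Matrix.mulVec_add, ha, hb]
  have e0 : (Pi.single 0 1 : Fin 8 → ℤ) = v 6 - v 4 := by decide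
  have e1 : (Pi.single 1 1 : Fin 8 → ℤ) = v 7 - v 3 := by decide
  have e2 : (Pi.single 2 1 : Fin 8 → ℤ) = v 4 := by decide
  have e3 : (Pi.single 3 1 : Fin 8 → ℤ) = v 3 := by decide
  have e4 : (Pi.single 4 1 : Fin 8 → ℤ) = v 2 := by decide
  have e5 : (Pi.single 5 1 : Fin 8 → ℤ) = v 1 := by decide
  have e6 : (Pi.single 6 1 : Fin 8 → ℤ) = v 0 := by decide
  have e7 : (Pi.single 7 1 : Fin 8 → ℤ) = v 5 - v 7 + v 3 := by decide
  refine chebyshevMatrix_eq_one fun i => ?_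
  fin_cases i
  · exact e0 ▸ hsub (hv 6 (by omega)) (hv 4 (by omega))
  · exact e1 ▸ hsub (hv 7 (by omega)) (hv 3 (by omega))
  · exact e2 ▸ hv 4 (by omega)
  · exact e3 ▸ hv 3 (by omega)
  · exact e4 ▸ hv 2 (by omega)
  · exact e5 ▸ hv 1 (by omega)
  · exact e6 ▸ hv 0 (by omega)
  · exact e7 ▸ hadd (hsub (hv 5 (by omega)) (hv 7 (by omega))) (hv 3 (by omega))

end

/-! ### The periods -/

theorem mainTheorem4 (K : Type v) (Λ : Type u) [Field K] [Ring Λ] [Algebra K Λ]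
    [Module.Finite K Λ] (hsymm : IsSymmetricAlg K Λ) (hrad : Ring.jacobson Λ ^ 3 = ⊥) :
    (∀ n : ℕ, 2 ≤ n → HasDiagram K Λ (diagramA n) →
      SimpleResolutionsHavePeriod Λ (2 * n)) ∧
    (∀ n : ℕ, 2 ≤ n → HasDiagram K Λ (diagramL n) →
      SimpleResolutionsHavePeriod Λ (2 * n)) ∧
    (∀ n : ℕ, 4 ≤ n → Even n → HasDiagram K Λ (diagramD n) →
      SimpleResolutionsHavePeriod Λ (2 * n - 3)) ∧
    (∀ n : ℕ, 4 ≤ n → Odd n → HasDiagram K Λ (diagramD n) →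
      SimpleResolutionsHavePeriod Λ (2 * (2 * n - 3))) ∧
    (HasDiagram K Λ (diagramE 6) → SimpleResolutionsHavePeriod Λ 22) ∧
    (HasDiagram K Λ (diagramE 7) → SimpleResolutionsHavePeriod Λ 17) ∧
    (HasDiagram K Λ (diagramE 8) → SimpleResolutionsHavePeriod Λ 29) := by
  refine ⟨fun n hn h => ?_, fun n hn h => ?_, fun n hn he h => ?_, fun n hn ho h => ?_, fun h => ?_,
    fun h => ?_, fun h => ?_⟩
  · have hz : FirstZeroAt (diagramA n) ⟨0, by omega⟩ (n - 1 + 1) := by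
      rw [Nat.sub_add_cancel (by omega)]
      exact firstZeroAt_A hn
    have := (h.havePeriod hsymm hrad hn (adjacencyOf_comm _ _) (adjacencyOf_le_one _ _)
      (isConnectedDiagram_A hn) hz).2 (chebyshevMatrix_A_ne_one hn)
    rwa [Nat.sub_add_cancel (by omega)] at this
  · have hz : FirstZeroAt (diagramL n) ⟨n - 1, by omega⟩ (2 * n - 1 + 1) := by
      rw [Nat.sub_add_cancel (by omega)]
      exact firstZeroAt_L hn
    have := (h.havePeriod hsymm hrad hn (adjacencyOf_comm _ _) (adjacencyOf_le_one _ _)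
      (isConnectedDiagram_L hn) hz).1 (chebyshevMatrix_L_eq_one hn)
    rwa [Nat.sub_add_cancel (by omega)] at this
  · have h1 : 2 * n - 3 = 2 * n - 4 + 1 := by omega
    rw [h1]
    exact (h.havePeriod hsymm hrad (by omega) (adjacencyOf_comm _ _) (adjacencyOf_le_one _ _)
      (isConnectedDiagram_D hn) (h1 ▸ firstZeroAt_D hn)).1 (chebyshevMatrix_D_eq_one hn he)
  · have h1 : 2 * n - 3 = 2 * n - 4 + 1 := by omega
    rw [h1]
    exact (h.havePeriod hsymm hrad (by omega) (adjacencyOf_comm _ _) (adjacencyOf_le_one _ _)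
      (isConnectedDiagram_D hn) (h1 ▸ firstZeroAt_D hn)).2 (chebyshevMatrix_D_ne_one hn ho)
  · exact (h.havePeriod hsymm hrad (by omega) (adjacencyOf_comm _ _) (adjacencyOf_le_one _ _)
      (isConnectedDiagram_E (by omega)) firstZeroAt_E6).2 chebyshevMatrix_E6_ne_one
  · exact (h.havePeriod hsymm hrad (by omega) (adjacencyOf_comm _ _) (adjacencyOf_le_one _ _)
      (isConnectedDiagram_E (by omega)) firstZeroAt_E7).1 chebyshevMatrix_E7_eq_one
  · exact (h.havePeriod hsymm hrad (by omega) (adjacencyOf_comm _ _) (adjacencyOf_le_one _ _)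
      (isConnectedDiagram_E (by omega)) firstZeroAt_E8).1 chebyshevMatrix_E8_eq_one
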